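/- Let $G$ be a group with neutral element $e$. **The operad.** Let $\mathsf{PBr}^G$ (parenthesized $G$-braids) be the symmetric $G$-coloured operad in groupoids with the following presentation. *Generating operations* (one for every choice of the input colours): a unit $\eta:()\to e$; an operation $[k]:g\to kgk^{-1}$ for each $k\in G$; a product $\mu:(g,g')\to gg'$. The objects form the free symmetric coloured operad on these operations. *Generating isomorphisms* (for all admissible input colours; the numbers denote inputs): $\alpha:\mu(\mu(1,2),3)\to\mu(1,\mu(2,3))$, $\ell:\mu(\eta,1)\to 1$, $r:\mu(1,\eta)\to 1$, $c:\mu(1,2)\to\mu([a]2,1)$ with $a$ the colour of input $1$, $\beta:\mu([k]1,[k]2)\to[k]\mu(1,2)$, $\gamma:[k][k']1\to[kk']1$, $\delta:[e]1\to 1$, $\varepsilon:[k]\eta\to\eta$. *Relations*: the pentagon for $\alpha$; the triangle for $\alpha,\ell,r$; and, for all $k,k',k''\in G$ and all input colours (with $a_i$ the colour of input $i$; composition is written in diagrammatic order and $\mu(f,f')$, $[k]f$ denote the operations applied to morphisms): * (G1) $\mu(\beta,\mathrm{id})\,\beta\,[k]\alpha=\alpha\,\mu(\mathrm{id},\beta)\,\beta$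 as morphisms $\mu(\mu([k]1,[k]2),[k]3)\to[k]\mu(1,\mu(2,3))$; * (G2) $\mu(\varepsilon,\mathrm{id})\,\ell=\beta\,[k]\ell$ as morphisms $\mu([k]\eta,[k]1)\to[k]1$, and $\mu(\mathrm{id},\varepsilon)\,r=\beta\,[k]r$ as morphisms $\mu([k]1,[k]\eta)\to[k]1$; * (G3) $\gamma=\delta:[e][k]1\to[k]1$ and $\gamma=[k]\delta:[k][e]1\to[k]1$; * (G4) the two morphisms $[k''][k'][k]1\to[k''k'k]1$ built from $\gamma$ agree; * (G5) $\mu(\delta,\delta)=\beta\,\delta:\mu([e]1,[e]2)\to\mu(1,2)$; * (G6) $\varepsilon=\delta:[e]\eta\to\eta$; * (G7) $\mu(\varepsilon,\varepsilon)\,\ell=\beta\,[k]\ell\,\varepsilon:\mu([k]\eta,[k]\eta)\to\eta$; * (G8) $\mu(\gamma,\gamma)\,\beta=\beta\,[k]\beta\,\gamma:\mu([k][k']1,[k][k']2)\to[kk']\mu(1,2)$; * (G9) $\beta\,[k]c\,\beta^{-1}\,\mu(\gamma,\mathrm{id})=c\,\mu(\gamma,\mathrm{id}):\mu([k]1,[k]2)\to\mu([ka_1]2,[k]1)$;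 * (G10) the two hexagons: $c\,\alpha^{-1}=\alpha\,\mu(\mathrm{id},c)\,\alpha^{-1}\,\mu(c,\mathrm{id})\,\mu(\mu(\gamma,\mathrm{id}),\mathrm{id})$ as morphisms $\mu(\mu(1,2),3)\to\mu(\mu([a_1a_2]3,1),2)$, and $c\,\mu(\beta^{-1},\mathrm{id})\,\alpha=\alpha^{-1}\,\mu(c,\mathrm{id})\,\alpha\,\mu(\mathrm{id},c)$ as morphisms $\mu(1,\mu(2,3))\to\mu([a_1]2,\mu([a_1]3,1))$. For $h\in G$ and $\underline g=(g_1,\dots,g_r)\in G^r$, $r\ge 0$, let $\mathsf{PBr}^G\binom{h}{\underline g}$ be the groupoid of operations with input colours $g_1,\dots,g_r$ and output colour $h$. **The action groupoid.** For $(\sigma,\underline b)\in\Sigma_r\times G^r$ and $1\le p\le r$ put $a_p:=b_p\,g_{\sigma^{-1}(p)}\,b_p^{-1}$ (input $i$ is placed at position $\sigma(i)$ and position $p$ is labelled by $b_p$), and let $$\Sigma_r\times_hG^r:=\{(\sigma,\underline b)\in\Sigma_r\times G^r\mid a_1a_2\cdots a_r=h\}.$$ Let $B_r$ be the braid group on $r$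 strands, with generators $c_{j,j+1}$ for $1\le j\le r-1$. The formula $$c_{j,j+1}.(\sigma,\underline b)=\bigl(\tau_{j,j+1}\sigma,\ (b_1,\dots,b_{j-1},\,a_jb_{j+1},\,b_j,\,b_{j+2},\dots,b_r)\bigr),$$ where $\tau_{j,j+1}$ is the transposition of $j$ and $j+1$, defines an action of $B_r$ on $\Sigma_r\times_hG^r$; on the tuples $\underline a$ it is the Hurwitz action $(\dots,a_j,a_{j+1},\dots)\mapsto(\dots,a_ja_{j+1}a_j^{-1},a_j,\dots)$. **Proposition.** For all $h\in G$ and $\underline g\in G^r$ there is an equivalence of groupoids $$\mathsf{PBr}^G\binom{h}{\underline g}\simeq(\Sigma_r\times_hG^r)/\!/B_r .$$ -/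

import Mathlib

open CategoryTheory

universe u v w

namespace GBraid

/-! ### Operations of the `G`-coloured operad of parenthesized `G`-braids

The generating operations are the unit `() → 1`, the operations `[h] : g → h g h⁻¹` and the
products `(g, g') → g g'`, one for every choice of the input colours. -/

/-- Planar trees built from the generating operations, with leaves labelled in `X`.
Once the leaves are coloured there is exactly one way to colour the edges of such a tree by
generating operations, see `GTree.color`; so the colours are not recorded in the tree. -/
inductive GTree (G : Type u) (X : Type v) : Type (max u v)
  | leaf (x : X) : GTree G X
  | unit : GTree G X
  | act (h : G) (t : GTree G X) : GTree G X
  | mul (s t : GTree G X) : GTree G X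

namespace GTree

/-- The colour of the root of a tree whose leaf `x` has colour `g x`. -/
def color {G : Type u} [Group G] {X : Type v} (g : X → G) : GTree G X → G
  | leaf x => g x
  | unit => 1
  | act h t => h * color g t * h⁻¹
  | mul s t => color g s * color g t

/-- The labels of the leaves, from left to right. -/
def leaves {G : Type u} {X : Type v} : GTree G X → List X
  | leaf x => [x]
  | unit => []
  | act _ t => leaves t
  | mul s t => leaves s ++ leaves t

/-- Every label occurs exactly once, i.e. the tree is an operation with one input for every
element of `X`. -/
def IsLinear {G : Type u} {X : Type v} (t : GTree G X) : Prop :=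
  t.leaves.Nodup ∧ ∀ x, x ∈ t.leaves

/-- Operadic composition of operations: graft the tree `t y` onto the leaf `y`. With every `t y`
a leaf, this is the action of the symmetric groups (renumbering of the inputs). -/
def graft {G : Type u} {X : Type v} {Y : Type w} (t : Y → GTree G X) : GTree G Y → GTree G X
  | leaf y => t y
  | unit => unit
  | act h s => act h (graft t s)
  | mul s s' => mul (graft t s) (graft t s')

theorem color_graft {G : Type u} [Group G] {X : Type v} {Y : Type w} {g : X → G} {k : Y → G}
    {t : Y → GTree G X} (ht : ∀ y, (t y).color g = k y) (s : GTree G Y) :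
    (s.graft t).color g = s.color k := by
  induction s with
  | leaf y => exact ht y
  | unit => rfl
  | act h s ih => simp only [graft, color, ih]
  | mul s s' ih ih' => simp only [graft, color, ih, ih']

end GTree

open GTree

/-! ### Morphisms -/

/-- Formal morphisms between trees. They are generated, under composition, inversion and operadic
composition, by the isomorphisms
* `α : μ(μ(1,2),3) → μ(1,μ(2,3))`, `ℓ : μ(η,1) → 1`, `r : μ(1,η) → 1`,
* the braiding `c : μ(1,2) → μ([a]2,1)`, where `a` is the colour of the input `1`,
* `β : μ([h]1,[h]2) → [h]μ(1,2)`, `γ : [k][h]1 → [k h]1`, `δ : [1]1 → 1`, `ε : [h]η → η`.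

Operadic composition enters in two ways: the inputs of a generating isomorphism may be arbitrary
trees, and the generating operations may be applied to morphisms (`actMap`, `mulMap`). -/
inductive PreHom {G : Type u} [Group G] {X : Type v} (g : X → G) :
    GTree G X → GTree G X → Type (max u v)
  | id (s : GTree G X) : PreHom g s s
  | comp {s t u : GTree G X} (f : PreHom g s t) (f' : PreHom g t u) : PreHom g s u
  | inv {s t : GTree G X} (f : PreHom g s t) : PreHom g t s
  | actMap (h : G) {s t : GTree G X} (f : PreHom g s t) : PreHom g (act h s) (act h t)
  | mulMap {s t s' t' : GTree G X} (f : PreHom g s t) (f' : PreHom g s' t') :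
      PreHom g (mul s s') (mul t t')
  | alpha (s t u : GTree G X) : PreHom g (mul (mul s t) u) (mul s (mul t u))
  | ell (s : GTree G X) : PreHom g (mul unit s) s
  | rho (s : GTree G X) : PreHom g (mul s unit) s
  | braid (s t : GTree G X) (a : G) (ha : s.color g = a) : PreHom g (mul s t) (mul (act a t) s)
  | beta (h : G) (s t : GTree G X) : PreHom g (mul (act h s) (act h t)) (act h (mul s t))
  | gamma (k h l : G) (hl : k * h = l) (s : GTree G X) : PreHom g (act k (act h s)) (act l s)
  | delta (s : GTree G X) : PreHom g (act 1 s) s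
  | eps (h : G) : PreHom g (act h unit) unit

infixr:80 " ⋙ₚ " => PreHom.comp

open PreHom

/-- The relations between formal morphisms: the smallest congruence satisfying
* the axioms of a groupoid,
* functoriality of operadic composition, i.e. functoriality of the generating operations and
  naturality of the generating isomorphisms,
* the defining relations (the constructors from `pentagon` on). -/
inductive Rel {G : Type u} [Group G] {X : Type v} (g : X → G) :
    ∀ {s t : GTree G X}, PreHom g s t → PreHom g s t → Prop
  -- congruence
  | refl {s t} (f : PreHom g s t) : Rel g f f
  | symm {s t} {f f' : PreHom g s t} : Rel g f f' → Rel g f' f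
  | trans {s t} {f f' f'' : PreHom g s t} : Rel g f f' → Rel g f' f'' → Rel g f f''
  | comp_congr {s t u} {f f' : PreHom g s t} {k k' : PreHom g t u} :
      Rel g f f' → Rel g k k' → Rel g (f ⋙ₚ k) (f' ⋙ₚ k')
  | inv_congr {s t} {f f' : PreHom g s t} : Rel g f f' → Rel g (inv f) (inv f')
  | act_congr (h : G) {s t} {f f' : PreHom g s t} :
      Rel g f f' → Rel g (.actMap h f) (.actMap h f')
  | mul_congr {s t s' t'} {f f' : PreHom g s t} {k k' : PreHom g s' t'} :
      Rel g f f' → Rel g k k' → Rel g (.mulMap f k) (.mulMap f' k')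
  -- groupoid axioms
  | id_comp {s t} (f : PreHom g s t) : Rel g (.id s ⋙ₚ f) f
  | comp_id {s t} (f : PreHom g s t) : Rel g (f ⋙ₚ .id t) f
  | comp_assoc {s t u v} (f : PreHom g s t) (f' : PreHom g t u) (f'' : PreHom g u v) :
      Rel g ((f ⋙ₚ f') ⋙ₚ f'') (f ⋙ₚ f' ⋙ₚ f'')
  | comp_inv {s t} (f : PreHom g s t) : Rel g (f ⋙ₚ inv f) (.id s)
  | inv_comp {s t} (f : PreHom g s t) : Rel g (inv f ⋙ₚ f) (.id t)
  -- functoriality of the generating operations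
  | act_id (h : G) (s) : Rel g (.actMap h (.id s)) (.id (act h s))
  | act_comp (h : G) {s t u} (f : PreHom g s t) (k : PreHom g t u) :
      Rel g (.actMap h (f ⋙ₚ k)) (.actMap h f ⋙ₚ .actMap h k)
  | mul_id (s t) : Rel g (.mulMap (.id s) (.id t)) (.id (mul s t))
  | mul_comp {s t u s' t' u'} (f : PreHom g s t) (k : PreHom g t u) (f' : PreHom g s' t')
      (k' : PreHom g t' u') :
      Rel g (.mulMap (f ⋙ₚ k) (f' ⋙ₚ k')) (.mulMap f f' ⋙ₚ .mulMap k k')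
  -- naturality of the generating isomorphisms
  | alpha_nat {s t u s' t' u'} (f : PreHom g s s') (f' : PreHom g t t') (f'' : PreHom g u u') :
      Rel g (.mulMap (.mulMap f f') f'' ⋙ₚ alpha s' t' u')
        (alpha s t u ⋙ₚ .mulMap f (.mulMap f' f''))
  | ell_nat {s s'} (f : PreHom g s s') : Rel g (.mulMap (.id unit) f ⋙ₚ ell s') (ell s ⋙ₚ f)
  | rho_nat {s s'} (f : PreHom g s s') : Rel g (.mulMap f (.id unit) ⋙ₚ rho s') (rho s ⋙ₚ f)
  | braid_nat {s t s' t'} (f : PreHom g s s') (f' : PreHom g t t') (a : G) (ha : s.color g = a)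
      (ha' : s'.color g = a) :
      Rel g (.mulMap f f' ⋙ₚ braid s' t' a ha') (braid s t a ha ⋙ₚ .mulMap (.actMap a f') f)
  | beta_nat (h : G) {s t s' t'} (f : PreHom g s s') (f' : PreHom g t t') :
      Rel g (.mulMap (.actMap h f) (.actMap h f') ⋙ₚ beta h s' t')
        (beta h s t ⋙ₚ .actMap h (.mulMap f f'))
  | gamma_nat (k h l : G) (hl : k * h = l) {s s'} (f : PreHom g s s') :
      Rel g (.actMap k (.actMap h f) ⋙ₚ gamma k h l hl s') (gamma k h l hl s ⋙ₚ .actMap l f)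
  | delta_nat {s s'} (f : PreHom g s s') : Rel g (.actMap 1 f ⋙ₚ delta s') (delta s ⋙ₚ f)
  -- pentagon and triangle
  | pentagon (s t u v) :
      Rel g (.mulMap (alpha s t u) (.id v) ⋙ₚ alpha s (mul t u) v ⋙ₚ .mulMap (.id s) (alpha t u v))
        (alpha (mul s t) u v ⋙ₚ alpha s t (mul u v))
  | triangle (s t) :
      Rel g (alpha s unit t ⋙ₚ .mulMap (.id s) (ell t)) (.mulMap (rho s) (.id t))
  -- `[h]` is a monoidal functor
  | G1 (h : G) (s t u) :
      Rel g (.mulMap (beta h s t) (.id (act h u)) ⋙ₚ beta h (mul s t) u ⋙ₚ .actMap h (alpha s t u))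
        (alpha (act h s) (act h t) (act h u) ⋙ₚ .mulMap (.id (act h s)) (beta h t u) ⋙ₚ
          beta h s (mul t u))
  | G2_left (h : G) (s) :
      Rel g (.mulMap (eps h) (.id (act h s)) ⋙ₚ ell (act h s)) (beta h unit s ⋙ₚ .actMap h (ell s))
  | G2_right (h : G) (s) :
      Rel g (.mulMap (.id (act h s)) (eps h) ⋙ₚ rho (act h s)) (beta h s unit ⋙ₚ .actMap h (rho s))
  -- coherence of the action
  | G3_left (h : G) (s) :
      Rel g (gamma 1 h h (one_mul h) s) (delta (act h s))
  | G3_right (h : G) (s) :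
      Rel g (gamma h 1 h (mul_one h) s) (.actMap h (delta s))
  | G4 (h₃ h₂ h₁ k l m : G) (hk : h₃ * h₂ = k) (hl : h₂ * h₁ = l) (hm : k * h₁ = m)
      (hm' : h₃ * l = m) (s) :
      Rel g (gamma h₃ h₂ k hk (act h₁ s) ⋙ₚ gamma k h₁ m hm s)
        (.actMap h₃ (gamma h₂ h₁ l hl s) ⋙ₚ gamma h₃ l m hm' s)
  -- compatibility of the action and the product
  | G5 (s t) : Rel g (.mulMap (delta s) (delta t)) (beta 1 s t ⋙ₚ delta (mul s t))
  | G6 : Rel g (eps 1) (delta unit)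
  | G7 (h : G) :
      Rel g (.mulMap (eps h) (eps h) ⋙ₚ ell unit)
        (beta h unit unit ⋙ₚ .actMap h (ell unit) ⋙ₚ eps h)
  | G8 (k h l : G) (hl : k * h = l) (s t) :
      Rel g (.mulMap (gamma k h l hl s) (gamma k h l hl t) ⋙ₚ beta l s t)
        (beta k (act h s) (act h t) ⋙ₚ .actMap k (beta h s t) ⋙ₚ gamma k h l hl (mul s t))
  -- compatibility of the action and the braiding
  | G9 (h : G) (s t) (a b l : G) (ha : s.color g = a) (hb : (act h s).color g = b)
      (hl : h * a = l) (hl' : b * h = l) :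
      Rel g
        (beta h s t ⋙ₚ .actMap h (braid s t a ha) ⋙ₚ inv (beta h (act a t) s) ⋙ₚ
          .mulMap (gamma h a l hl t) (.id (act h s)))
        (braid (act h s) (act h t) b hb ⋙ₚ .mulMap (gamma b h l hl' t) (.id (act h s)))
  -- hexagons
  | G10_right (s t u) (a b c : G) (ha : s.color g = a) (hb : t.color g = b)
      (hc : (mul s t).color g = c) (hab : a * b = c) :
      Rel g
        (braid (mul s t) u c hc ⋙ₚ inv (alpha (act c u) s t))
        (alpha s t u ⋙ₚ .mulMap (.id s) (braid t u b hb) ⋙ₚ inv (alpha s (act b u) t) ⋙ₚ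
          .mulMap (braid s (act b u) a ha) (.id t) ⋙ₚ
          .mulMap (.mulMap (gamma a b c hab u) (.id s)) (.id t))
  | G10_left (s t u) (a : G) (ha : s.color g = a) :
      Rel g
        (braid s (mul t u) a ha ⋙ₚ .mulMap (inv (beta a t u)) (.id s) ⋙ₚ alpha (act a t) (act a u) s)
        (inv (alpha s t u) ⋙ₚ .mulMap (braid s t a ha) (.id u) ⋙ₚ alpha (act a t) s u ⋙ₚ
          .mulMap (.id (act a t)) (braid s u a ha))

/-! ### Operadic composition of morphisms

The formal morphisms are closed under operadic composition, and operadic composition is a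
well-defined functor modulo the relations. -/

/-- Operadic composition of a morphism with identities on the operations `t y`. -/
def PreHom.graft {G : Type u} [Group G] {X : Type v} {Y : Type w} {g : X → G} {k : Y → G}
    (t : Y → GTree G X) (ht : ∀ y, (t y).color g = k y) {s s' : GTree G Y} :
    PreHom k s s' → PreHom g (s.graft t) (s'.graft t)
  | .id _ => .id _
  | .comp f f' => .comp (f.graft t ht) (f'.graft t ht)
  | .inv f => .inv (f.graft t ht)
  | .actMap h f => .actMap h (f.graft t ht)
  | .mulMap f f' => .mulMap (f.graft t ht) (f'.graft t ht)
  | .alpha _ _ _ => .alpha _ _ _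
  | .ell _ => .ell _
  | .rho _ => .rho _
  | .braid _ _ a ha => .braid _ _ a ((color_graft ht _).trans ha)
  | .beta h _ _ => .beta h _ _
  | .gamma a b l hl _ => .gamma a b l hl _
  | .delta _ => .delta _
  | .eps h => .eps h

/-- Operadic composition of the identity of `s` with morphisms `φ y : t y → t' y`. -/
def PreHom.whisker {G : Type u} [Group G] {X : Type v} {Y : Type w} {g : X → G}
    {t t' : Y → GTree G X} (φ : ∀ y, PreHom g (t y) (t' y)) :
    ∀ s : GTree G Y, PreHom g (s.graft t) (s.graft t')
  | leaf y => φ y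
  | unit => .id _
  | act h s => .actMap h (PreHom.whisker φ s)
  | mul s s' => .mulMap (PreHom.whisker φ s) (PreHom.whisker φ s')

theorem Rel.graft {G : Type u} [Group G] {X : Type v} {Y : Type w} {g : X → G} {k : Y → G}
    (t : Y → GTree G X) (ht : ∀ y, (t y).color g = k y) {s s' : GTree G Y}
    {f f' : PreHom k s s'} (hf : Rel k f f') : Rel g (f.graft t ht) (f'.graft t ht) := by
  induction hf with
  | symm _ ih => exact ih.symm
  | trans _ _ ih ih' => exact ih.trans ih'
  | comp_congr _ _ ih ih' => exact .comp_congr ih ih'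
  | inv_congr _ ih => exact .inv_congr ih
  | act_congr h _ ih => exact .act_congr h ih
  | mul_congr _ _ ih ih' => exact .mul_congr ih ih'
  | refl f => exact .refl _
  | id_comp => exact .id_comp _
  | comp_id => exact .comp_id _
  | comp_assoc => exact .comp_assoc _ _ _
  | comp_inv => exact .comp_inv _
  | inv_comp => exact .inv_comp _
  | act_id => exact .act_id _ _
  | act_comp => exact .act_comp _ _ _
  | mul_id => exact .mul_id _ _
  | mul_comp => exact .mul_comp _ _ _ _
  | alpha_nat => exact .alpha_nat _ _ _
  | ell_nat => exact .ell_nat _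
  | rho_nat => exact .rho_nat _
  | braid_nat => exact .braid_nat _ _ _ _ _
  | beta_nat => exact .beta_nat _ _ _
  | gamma_nat => exact .gamma_nat _ _ _ _ _
  | delta_nat => exact .delta_nat _
  | pentagon => exact .pentagon _ _ _ _
  | triangle => exact .triangle _ _
  | G1 => exact .G1 _ _ _ _
  | G2_left => exact .G2_left _ _
  | G2_right => exact .G2_right _ _
  | G3_left => exact .G3_left _ _
  | G3_right => exact .G3_right _ _
  | G4 => exact .G4 _ _ _ _ _ _ _ _ _ _ _
  | G5 => exact .G5 _ _
  | G6 => exact .G6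
  | G7 => exact .G7 _
  | G8 => exact .G8 _ _ _ _ _ _
  | G9 => exact .G9 _ _ _ _ _ _ _ _ _ _
  | G10_right => exact .G10_right _ _ _ _ _ _ _ _ _ _
  | G10_left => exact .G10_left _ _ _ _ _

theorem Rel.whisker {G : Type u} [Group G] {X : Type v} {Y : Type w} {g : X → G}
    {t t' : Y → GTree G X} {φ φ' : ∀ y, PreHom g (t y) (t' y)} (h : ∀ y, Rel g (φ y) (φ' y))
    (s : GTree G Y) : Rel g (PreHom.whisker φ s) (PreHom.whisker φ' s) := by
  induction s with
  | leaf y => exact h y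
  | unit => exact .refl _
  | act a s ih => exact .act_congr a ih
  | mul s s' ih ih' => exact .mul_congr ih ih'

theorem Rel.whisker_comp {G : Type u} [Group G] {X : Type v} {Y : Type w} {g : X → G}
    {t t' t'' : Y → GTree G X} (φ : ∀ y, PreHom g (t y) (t' y)) (ψ : ∀ y, PreHom g (t' y) (t'' y))
    (s : GTree G Y) :
    Rel g (PreHom.whisker (fun y => φ y ⋙ₚ ψ y) s)
      (PreHom.whisker φ s ⋙ₚ PreHom.whisker ψ s) := by
  induction s with
  | leaf y => exact .refl _
  | unit => exact (Rel.id_comp _).symm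
  | act a s ih => exact (Rel.act_congr a ih).trans (Rel.act_comp a _ _)
  | mul s s' ih ih' => exact (Rel.mul_congr ih ih').trans (Rel.mul_comp _ _ _ _)

/-- Interchange: composing operadically `f` with the family `φ` does not depend on the order. -/
theorem Rel.graft_whisker {G : Type u} [Group G] {X : Type v} {Y : Type w} {g : X → G}
    {k : Y → G} {t t' : Y → GTree G X} (ht : ∀ y, (t y).color g = k y)
    (ht' : ∀ y, (t' y).color g = k y) (φ : ∀ y, PreHom g (t y) (t' y)) {s s' : GTree G Y}
    (f : PreHom k s s') :
    Rel g (PreHom.whisker φ s ⋙ₚ f.graft t' ht') (f.graft t ht ⋙ₚ PreHom.whisker φ s') := by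
  induction f with
  | id s => exact (Rel.comp_id _).trans (Rel.id_comp _).symm
  | comp f f' ih ih' =>
    exact (Rel.comp_assoc _ _ _).symm.trans <| (Rel.comp_congr ih (.refl _)).trans <|
      (Rel.comp_assoc _ _ _).trans <| (Rel.comp_congr (.refl _) ih').trans
        (Rel.comp_assoc _ _ _).symm
  | inv f ih =>
    refine (Rel.id_comp _).symm.trans ?_
    refine (Rel.comp_congr (Rel.inv_comp (f.graft t ht)).symm (.refl _)).trans ?_
    refine (Rel.comp_assoc _ _ _).trans (Rel.comp_congr (.refl _) ?_)
    refine (Rel.comp_assoc _ _ _).symm.trans ?_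
    refine (Rel.comp_congr ih.symm (.refl _)).trans ?_
    refine (Rel.comp_assoc _ _ _).trans ?_
    exact (Rel.comp_congr (.refl _) (Rel.comp_inv _)).trans (Rel.comp_id _)
  | actMap h f ih =>
    exact (Rel.act_comp h _ _).symm.trans ((Rel.act_congr h ih).trans (Rel.act_comp h _ _))
  | mulMap f f' ih ih' =>
    exact (Rel.mul_comp _ _ _ _).symm.trans ((Rel.mul_congr ih ih').trans (Rel.mul_comp _ _ _ _))
  | alpha => exact .alpha_nat _ _ _
  | ell => exact .ell_nat _
  | rho => exact .rho_nat _
  | braid => exact .braid_nat _ _ _ _ _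
  | beta => exact .beta_nat _ _ _
  | gamma => exact .gamma_nat _ _ _ _ _
  | delta => exact .delta_nat _
  | eps h =>
    exact (Rel.comp_congr (Rel.act_id h unit) (.refl (PreHom.eps (g := g) h))).trans
      ((Rel.id_comp _).trans (Rel.comp_id _).symm)

/-! ### The components of the operad -/

/-- An object of the component of the operad with output colour `h` and input colours
`g 0, …, g (r-1)`: a tree whose leaves are numbered bijectively by the inputs. -/
structure PBr {G : Type u} [Group G] {r : ℕ} (h : G) (g : Fin r → G) : Type u where
  tree : GTree G (Fin r)
  color_eq : tree.color g = h
  isLinear : tree.IsLinear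

/-- The component groupoid. -/
instance PBr.instGroupoid {G : Type u} [Group G] {r : ℕ} (h : G) (g : Fin r → G) :
    Groupoid (PBr h g) where
  Hom x y := Quot (Rel g (s := x.tree) (t := y.tree))
  id x := Quot.mk _ (.id x.tree)
  comp {_ _ _} := Quot.map₂ PreHom.comp (fun _ _ _ h => .comp_congr (.refl _) h)
    (fun _ _ _ h => .comp_congr h (.refl _))
  inv {_ _} := Quot.map PreHom.inv (fun _ _ h => .inv_congr h)
  id_comp {_ _} f := Quot.inductionOn f fun _ => Quot.sound (.id_comp _)
  comp_id {_ _} f := Quot.inductionOn f fun _ => Quot.sound (.comp_id _)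
  assoc {_ _ _ _} f f' f'' := Quot.inductionOn f fun _ => Quot.inductionOn f' fun _ =>
    Quot.inductionOn f'' fun _ => Quot.sound (.comp_assoc _ _ _)
  inv_comp {_ _} f := Quot.inductionOn f fun _ => Quot.sound (.inv_comp _)
  comp_inv {_ _} f := Quot.inductionOn f fun _ => Quot.sound (.comp_inv _)

/-! ### The braid group and its action -/

/-- The relations of the braid group: `c_i c_j = c_j c_i` for `|i - j| ≥ 2` and
`c_i c_{i+1} c_i = c_{i+1} c_i c_{i+1}`. -/
inductive BraidRel (r : ℕ) : FreeGroup (Fin (r - 1)) → Prop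
  | far (i j : Fin (r - 1)) (h : (i : ℕ) + 2 ≤ j) :
      BraidRel r (FreeGroup.of i * FreeGroup.of j * (FreeGroup.of j * FreeGroup.of i)⁻¹)
  | braid (i j : Fin (r - 1)) (h : (i : ℕ) + 1 = j) :
      BraidRel r (FreeGroup.of i * FreeGroup.of j * FreeGroup.of i *
        (FreeGroup.of j * FreeGroup.of i * FreeGroup.of j)⁻¹)

/-- The braid group on `r` strands; its generator `j` braids the strands `j` and `j + 1`. -/
abbrev BraidGroup (r : ℕ) : Type := PresentedGroup {w | BraidRel r w}

/-- The position `j` among `r` positions, for a generator `j` of the braid group. -/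
def lo {r : ℕ} (j : Fin (r - 1)) : Fin r := ⟨j, by omega⟩

/-- The position `j + 1` among `r` positions, for a generator `j` of the braid group. -/
def hi {r : ℕ} (j : Fin (r - 1)) : Fin r := ⟨j + 1, by omega⟩

/-- `b_p g_{σ⁻¹(p)} b_p⁻¹`, the colour at the position `p` of the standard operation that places
the input `i` at the position `σ(i)` and labels the position `p` with `b_p`. -/
def posColor {G : Type u} [Group G] {r : ℕ} (g : Fin r → G)
    (x : Equiv.Perm (Fin r) × (Fin r → G)) (p : Fin r) : G :=
  x.2 p * g (x.1⁻¹ p) * (x.2 p)⁻¹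

/-- The set `Σ_r ×_h G^r` of pairs `(σ, b)` for which the product of the elements
`b_p g_{σ⁻¹(p)} b_p⁻¹`, in the order of the positions `p`, is `h`. -/
def SigmaSet {G : Type u} [Group G] {r : ℕ} (h : G) (g : Fin r → G) : Type u :=
  {x : Equiv.Perm (Fin r) × (Fin r → G) // (List.ofFn (posColor g x)).prod = h}

/-- The action of the `j`-th generator of the braid group,
`(σ, b) ↦ (τ_{j,j+1} σ, (…, a_j b_{j+1}, b_j, …))` with `a_j = b_j g_{σ⁻¹(j)} b_j⁻¹`. -/
def braidStep {G : Type u} [Group G] {r : ℕ} (g : Fin r → G) (j : Fin (r - 1))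
    (x : Equiv.Perm (Fin r) × (Fin r → G)) : Equiv.Perm (Fin r) × (Fin r → G) :=
  (Equiv.swap (lo j) (hi j) * x.1,
    fun p => if p = lo j then posColor g x (lo j) * x.2 (hi j)
      else if p = hi j then x.2 (lo j) else x.2 p)

theorem lo_ne_hi {r : ℕ} (j : Fin (r - 1)) : lo j ≠ hi j := by
  simp [lo, hi, Fin.ext_iff]

theorem posColor_braidStep {G : Type u} [Group G] {r : ℕ} (g : Fin r → G) (j : Fin (r - 1))
    (x : Equiv.Perm (Fin r) × (Fin r → G)) (p : Fin r) :
    posColor g (braidStep g j x) p =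
      if p = lo j then posColor g x (lo j) * posColor g x (hi j) * (posColor g x (lo j))⁻¹
      else if p = hi j then posColor g x (lo j) else posColor g x p := by
  have hne := lo_ne_hi j
  by_cases h1 : p = lo j
  · subst h1
    simp [posColor, braidStep, mul_assoc]
  · by_cases h2 : p = hi j
    · subst h2
      simp [posColor, braidStep, hne.symm]
    · simp [posColor, braidStep, h1, h2, Equiv.swap_apply_of_ne_of_ne]

theorem prod_ofFn_eq_of_adjacent {G : Type u} [Group G] : ∀ (r : ℕ) (f f' : Fin r → G) (j : ℕ)
    (hj : j + 1 < r), (∀ p : Fin r, (p : ℕ) ≠ j → (p : ℕ) ≠ j + 1 → f' p = f p) →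
    f' ⟨j, by omega⟩ * f' ⟨j + 1, hj⟩ = f ⟨j, by omega⟩ * f ⟨j + 1, hj⟩ →
    (List.ofFn f').prod = (List.ofFn f).prod
  | 0, _, _, _, hj, _, _ => by omega
  | 1, _, _, _, hj, _, _ => by omega
  | r + 2, f, f', 0, hj, h, h2 => by
      have h3 : (fun i : Fin r => f' i.succ.succ) = fun i => f i.succ.succ := by
        funext i
        exact h _ (by simp) (by simp)
      have h4 : f' 0 * f' (Fin.succ 0) = f 0 * f (Fin.succ 0) := h2
      simp only [List.ofFn_succ, List.prod_cons, ← mul_assoc, h4, h3]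
  | r + 2, f, f', j + 1, hj, h, h2 => by
      have h3 : f' 0 = f 0 := h 0 (by simp) (by simp)
      have h4 := prod_ofFn_eq_of_adjacent (r + 1) (fun i => f i.succ) (fun i => f' i.succ) j
        (by omega) (fun p hp hp' => h _ (by simpa using hp) (by simpa using hp')) h2
      rw [List.ofFn_succ, List.ofFn_succ (f := f), List.prod_cons, List.prod_cons, h3, h4]

theorem prod_posColor_braidStep {G : Type u} [Group G] {r : ℕ} (g : Fin r → G) (j : Fin (r - 1))
    (x : Equiv.Perm (Fin r) × (Fin r → G)) :
    (List.ofFn (posColor g (braidStep g j x))).prod = (List.ofFn (posColor g x)).prod := by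
  have hne := lo_ne_hi j
  refine prod_ofFn_eq_of_adjacent r _ _ j (by omega) (fun p h1 h2 => ?_) ?_
  · rw [posColor_braidStep, if_neg, if_neg]
    · simpa [hi, Fin.ext_iff] using h2
    · simpa [lo, Fin.ext_iff] using h1
  · change posColor g (braidStep g j x) (lo j) * posColor g (braidStep g j x) (hi j) =
      posColor g x (lo j) * posColor g x (hi j)
    rw [posColor_braidStep, posColor_braidStep]
    simp [hne.symm]

/-- The inverse of `braidStep`. -/
def braidStepInv {G : Type u} [Group G] {r : ℕ} (g : Fin r → G) (j : Fin (r - 1))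
    (x : Equiv.Perm (Fin r) × (Fin r → G)) : Equiv.Perm (Fin r) × (Fin r → G) :=
  (Equiv.swap (lo j) (hi j) * x.1,
    fun p => if p = lo j then x.2 (hi j)
      else if p = hi j then (posColor g x (hi j))⁻¹ * x.2 (lo j) else x.2 p)

/-- `braidStep` as a permutation of `Σ_r × G^r`. -/
def braidEquiv {G : Type u} [Group G] {r : ℕ} (g : Fin r → G) (j : Fin (r - 1)) :
    Equiv.Perm (Equiv.Perm (Fin r) × (Fin r → G)) where
  toFun := braidStep g j
  invFun := braidStepInv g j
  left_inv x := by
    have hne := lo_ne_hi j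
    refine Prod.ext ?_ (funext fun p => ?_)
    · simp [braidStep, braidStepInv]
    · simp only [braidStepInv, posColor_braidStep]
      by_cases h1 : p = lo j
      · subst h1; simp [braidStep, hne.symm]
      · by_cases h2 : p = hi j
        · subst h2; simp [braidStep, hne.symm]
        · simp [braidStep, h1, h2]
  right_inv x := by
    have hne := lo_ne_hi j
    refine Prod.ext ?_ (funext fun p => ?_)
    · simp [braidStep, braidStepInv]
    · by_cases h1 : p = lo j
      · subst h1; simp [braidStep, braidStepInv, posColor, hne.symm, mul_assoc]
      · by_cases h2 : p = hi j
        · subst h2; simp [braidStep, braidStepInv, hne.symm]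
        · simp [braidStep, braidStepInv, h1, h2]

/-- The action of the `j`-th generator of the braid group on `Σ_r ×_h G^r`. -/
def braidPerm {G : Type u} [Group G] {r : ℕ} (h : G) (g : Fin r → G) (j : Fin (r - 1)) :
    Equiv.Perm (SigmaSet h g) :=
  (braidEquiv g j).subtypePerm fun x => by
    rw [show braidEquiv g j x = braidStep g j x from rfl, prod_posColor_braidStep]

theorem braidStep_far {G : Type u} [Group G] {r : ℕ} (g : Fin r → G) (i j : Fin (r - 1))
    (hij : (i : ℕ) + 2 ≤ j) (x : Equiv.Perm (Fin r) × (Fin r → G)) :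
    braidStep g i (braidStep g j x) = braidStep g j (braidStep g i x) := by
  have e1 : lo i ≠ lo j := by simp [lo, Fin.ext_iff]; omega
  have e2 : lo i ≠ hi j := by simp [lo, hi, Fin.ext_iff]; omega
  have e3 : hi i ≠ lo j := by simp [lo, hi, Fin.ext_iff]; omega
  have e4 : hi i ≠ hi j := by simp [hi, Fin.ext_iff]; omega
  have ei := lo_ne_hi i
  have ej := lo_ne_hi j
  refine Prod.ext ?_ (funext fun p => ?_)
  · simp only [braidStep, ← mul_assoc]
    congr 1
    refine (Equiv.Perm.Disjoint.commute ?_).eq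
    intro p
    by_cases h1 : p = lo i
    · right; subst h1; exact Equiv.swap_apply_of_ne_of_ne e1 e2
    · by_cases h2 : p = hi i
      · right; subst h2; exact Equiv.swap_apply_of_ne_of_ne e3 e4
      · left; exact Equiv.swap_apply_of_ne_of_ne h1 h2
  · change (if p = lo i then posColor g (braidStep g j x) (lo i) * (braidStep g j x).2 (hi i)
        else if p = hi i then (braidStep g j x).2 (lo i) else (braidStep g j x).2 p) =
      (if p = lo j then posColor g (braidStep g i x) (lo j) * (braidStep g i x).2 (hi j)
        else if p = hi j then (braidStep g i x).2 (lo j) else (braidStep g i x).2 p)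
    simp only [posColor_braidStep, e1, e2, e1.symm, e3.symm, if_false]
    simp only [braidStep, e1, e2, e3, e4, e1.symm, e2.symm, e3.symm, e4.symm, if_false]
    by_cases h1 : p = lo i
    · subst h1; simp [e1, e2]
    · by_cases h2 : p = hi i
      · subst h2; simp [e3, e4]
      · simp [h1, h2]

theorem braidStep_braid {G : Type u} [Group G] {r : ℕ} (g : Fin r → G) (i j : Fin (r - 1))
    (hij : (i : ℕ) + 1 = j) (x : Equiv.Perm (Fin r) × (Fin r → G)) :
    braidStep g i (braidStep g j (braidStep g i x)) =
      braidStep g j (braidStep g i (braidStep g j x)) := by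
  have e1 : hi i = lo j := by simp [lo, hi, Fin.ext_iff]; omega
  have e2 : lo i ≠ hi j := by simp [lo, hi, Fin.ext_iff]; omega
  have ei := lo_ne_hi i
  have ej := lo_ne_hi j
  rw [e1] at ei
  refine Prod.ext ?_ (funext fun p => ?_)
  · simp only [braidStep, ← mul_assoc, e1]
    congr 1
    rw [Equiv.swap_mul_swap_mul_swap ei e2, Equiv.swap_comm (lo i) (lo j),
      Equiv.swap_comm (lo j) (hi j), Equiv.swap_mul_swap_mul_swap ej.symm e2.symm,
      Equiv.swap_comm]
  · have key : ∀ (k : Fin (r - 1)) (y : Equiv.Perm (Fin r) × (Fin r → G)) (q : Fin r),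
        (braidStep g k y).2 q = if q = lo k then posColor g y (lo k) * y.2 (hi k)
          else if q = hi k then y.2 (lo k) else y.2 q := fun _ _ _ => rfl
    simp only [key, posColor_braidStep, e1]
    by_cases h1 : p = lo i
    · subst h1; simp [ei, ei.symm, ej.symm, e2, e2.symm, mul_assoc]
    · by_cases h2 : p = lo j
      · subst h2; simp [ei, ei.symm, ej.symm, e2, e2.symm]
      · by_cases h3 : p = hi j
        · subst h3; simp [ei, ei.symm, ej.symm, e2, e2.symm]
        · simp [h1, h2, h3]

/-- The homomorphism from the braid group to the permutations of `Σ_r ×_h G^r` that sends the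
generator `j` to `braidPerm h g j`. -/
def braidHom {G : Type u} [Group G] {r : ℕ} (h : G) (g : Fin r → G) :
    BraidGroup r →* Equiv.Perm (SigmaSet h g) :=
  PresentedGroup.toGroup (f := braidPerm h g) (by
    rintro w (⟨i, j, hij⟩ | ⟨i, j, hij⟩)
    · simp only [map_mul, map_inv, FreeGroup.lift_apply_of, mul_inv_eq_one]
      exact Equiv.ext fun x => Subtype.ext (braidStep_far g i j hij x.1)
    · simp only [map_mul, map_inv, FreeGroup.lift_apply_of, mul_inv_eq_one]
      exact Equiv.ext fun x => Subtype.ext (braidStep_braid g i j hij x.1))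

/-- The action of the braid group on `Σ_r ×_h G^r`. -/
instance SigmaSet.instMulAction {G : Type u} [Group G] {r : ℕ} (h : G) (g : Fin r → G) :
    MulAction (BraidGroup r) (SigmaSet h g) :=
  MulAction.compHom (SigmaSet h g) (braidHom h g)

theorem of_smul_val {G : Type u} [Group G] {r : ℕ} (h : G) (g : Fin r → G) (j : Fin (r - 1))
    (x : SigmaSet h g) :
    ((PresentedGroup.of j : BraidGroup r) • x).1 = braidStep g j x.1 := by
  change ((braidHom h g (PresentedGroup.of j)) x).1 = _
  rw [braidHom, PresentedGroup.toGroup.of]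
  rfl

end GBraid

/-!
Forgetting labels and parentheses, a formal morphism between operations with `r` inputs has an
underlying braid, and this braid respects all relations. Conversely, the labelled leaves of a tree
form a word, and the tree is isomorphic to the product of its letters. Swaps of adjacent letters
satisfy the Yang–Baxter equation, so the braid group acts on pairs of a word `w` and a morphism
`o ⟶ ∏ w`. Up to the normal forms, every formal morphism acts as its underlying braid: the
structural isomorphisms act trivially, and the hexagons, (G9) and the braidings with the unit
reduce the braiding of two trees to swaps of letters. So a morphism is determined by its braid. The
swaps realize the generators of the braid group, and every element of `Σ_r ×_h G^r` is the word of
a product of letters; hence sending a morphism to its braid is an equivalence.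
-/

namespace GBraid

/-! ### Crossed braided categories -/

section CrossedBraided

open MonoidalCategory

/-- A `G`-crossed braided monoidal category: a monoidal category graded by `color`, on which `G`
acts by monoidal functors `act h`, with a braiding that moves `s` past `t` at the cost of acting
on `t` by the colour of `s`. The fields `braid`, `beta`, `gamma`, `delta`, `eps` are `c`, `β`, `γ`,
`δ`, `ε`; the equations are (G1)–(G4) and (G8)–(G10), which imply (G5)–(G7). Labels are carried
with an equation (`ha`, `hl`), so that no transport between objects `act a t` and `act a' t` with
`a = a'` is ever needed. -/
class CrossedBraidedCategory (G : outParam (Type*)) [Group G] (C : Type*) [Category* C]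
    [MonoidalCategory C] where
  color : C → G
  color_unit : color (𝟙_ C) = 1
  color_tensor (s t : C) : color (s ⊗ t) = color s * color t
  act : G → C ⥤ C
  color_act (h : G) (s : C) : color ((act h).obj s) = h * color s * h⁻¹
  braid (s t : C) {a : G} (ha : color s = a) : s ⊗ t ≅ (act a).obj t ⊗ s
  beta (h : G) (s t : C) : (act h).obj s ⊗ (act h).obj t ≅ (act h).obj (s ⊗ t)
  gamma {k h l : G} (hl : k * h = l) (s : C) : (act k).obj ((act h).obj s) ≅ (act l).obj s
  delta (s : C) : (act 1).obj s ≅ s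
  eps (h : G) : (act h).obj (𝟙_ C) ≅ 𝟙_ C
  braid_naturality {s s' t t' : C} (f : s ⟶ s') (f' : t ⟶ t') {a : G} (ha : color s = a)
      (ha' : color s' = a) :
    (f ⊗ₘ f') ≫ (braid s' t' ha').hom = (braid s t ha).hom ≫ ((act a).map f' ⊗ₘ f)
  beta_naturality (h : G) {s s' t t' : C} (f : s ⟶ s') (f' : t ⟶ t') :
    ((act h).map f ⊗ₘ (act h).map f') ≫ (beta h s' t').hom =
      (beta h s t).hom ≫ (act h).map (f ⊗ₘ f')
  gamma_naturality {k h l : G} (hl : k * h = l) {s s' : C} (f : s ⟶ s') :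
    (act k).map ((act h).map f) ≫ (gamma hl s').hom = (gamma hl s).hom ≫ (act l).map f
  delta_naturality {s s' : C} (f : s ⟶ s') : (act 1).map f ≫ (delta s').hom = (delta s).hom ≫ f
  beta_assoc (h : G) (s t u : C) :
    (beta h s t).hom ▷ (act h).obj u ≫ (beta h (s ⊗ t) u).hom ≫ (act h).map (α_ s t u).hom =
      (α_ _ _ _).hom ≫ (act h).obj s ◁ (beta h t u).hom ≫ (beta h s (t ⊗ u)).hom
  eps_leftUnitor (h : G) (s : C) :
    (eps h).hom ▷ (act h).obj s ≫ (λ_ _).hom = (beta h (𝟙_ C) s).hom ≫ (act h).map (λ_ s).hom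
  eps_rightUnitor (h : G) (s : C) :
    (act h).obj s ◁ (eps h).hom ≫ (ρ_ _).hom = (beta h s (𝟙_ C)).hom ≫ (act h).map (ρ_ s).hom
  gamma_one_left (h : G) (s : C) : (gamma (one_mul h) s).hom = (delta ((act h).obj s)).hom
  gamma_one_right (h : G) (s : C) : (gamma (mul_one h) s).hom = (act h).map (delta s).hom
  gamma_gamma {h₃ h₂ h₁ k l m : G} (hk : h₃ * h₂ = k) (hl : h₂ * h₁ = l) (hm : k * h₁ = m)
      (hm' : h₃ * l = m) (s : C) :
    (gamma hk ((act h₁).obj s)).hom ≫ (gamma hm s).hom =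
      (act h₃).map (gamma hl s).hom ≫ (gamma hm' s).hom
  gamma_beta {k h l : G} (hl : k * h = l) (s t : C) :
    ((gamma hl s).hom ⊗ₘ (gamma hl t).hom) ≫ (beta l s t).hom =
      (beta k _ _).hom ≫ (act k).map (beta h s t).hom ≫ (gamma hl (s ⊗ t)).hom
  beta_braid {h a b l : G} {s : C} (t : C) (ha : color s = a) (hb : color ((act h).obj s) = b)
      (hl : h * a = l) (hl' : b * h = l) :
    (beta h s t).hom ≫ (act h).map (braid s t ha).hom ≫ (beta h ((act a).obj t) s).inv ≫
        (gamma hl t).hom ▷ (act h).obj s =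
      (braid _ _ hb).hom ≫ (gamma hl' t).hom ▷ (act h).obj s
  braid_tensor_left {a b c : G} {s t : C} (u : C) (ha : color s = a) (hb : color t = b)
      (hc : color (s ⊗ t) = c) (hab : a * b = c) :
    (braid (s ⊗ t) u hc).hom ≫ (α_ _ s t).inv =
      (α_ s t u).hom ≫ s ◁ (braid t u hb).hom ≫ (α_ _ _ _).inv ≫
        (braid s ((act b).obj u) ha).hom ▷ t ≫ (gamma hab u).hom ▷ s ▷ t
  braid_tensor_right {a : G} {s : C} (t u : C) (ha : color s = a) :
    (braid s (t ⊗ u) ha).hom ≫ (beta a t u).inv ▷ s ≫ (α_ _ _ s).hom =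
      (α_ s t u).inv ≫ (braid s t ha).hom ▷ u ≫ (α_ _ s u).hom ≫
        (act a).obj t ◁ (braid s u ha).hom

namespace CrossedBraidedCategory

variable {C : Type*} [Category* C] [MonoidalCategory C]

section Monoidal

theorem eq_comp_of_unit_hexagon {u v w : C} (e : u ⟶ v) (e' : v ⟶ w) (d : w ⟶ v)
    (H : ((λ_ (𝟙_ C)).hom ▷ u ≫ ((λ_ u).hom ≫ e ≫ (ρ_ v).inv) ≫ v ◁ (λ_ (𝟙_ C)).inv) ≫
        (α_ v (𝟙_ C) (𝟙_ C)).inv =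
      (α_ (𝟙_ C) (𝟙_ C) u).hom ≫ 𝟙_ C ◁ ((λ_ u).hom ≫ e ≫ (ρ_ v).inv) ≫
        (α_ (𝟙_ C) v (𝟙_ C)).inv ≫ ((λ_ v).hom ≫ e' ≫ (ρ_ w).inv) ▷ 𝟙_ C ≫
        d ▷ 𝟙_ C ▷ 𝟙_ C) :
    e = e ≫ e' ≫ d := by
  rw [← cancel_mono ((ρ_ v).inv ≫ (ρ_ _).inv),
    ← cancel_epi ((α_ (𝟙_ C) (𝟙_ C) u).hom ≫ (λ_ _).hom ≫ (λ_ _).hom)]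
  calc
    _ = ((λ_ (𝟙_ C)).hom ▷ u ≫ ((λ_ u).hom ≫ e ≫ (ρ_ v).inv) ≫ v ◁ (λ_ (𝟙_ C)).inv) ≫
        (α_ v (𝟙_ C) (𝟙_ C)).inv := by monoidal
    _ = _ := H
    _ = _ := by monoidal

theorem eq_comp_self_of_unit_hexagon {s w : C} (e : s ⟶ s) (i : w ≅ 𝟙_ C) (k : w ⟶ w ⊗ w)
    (hk : k ≫ (i.hom ⊗ₘ i.hom) ≫ (λ_ (𝟙_ C)).hom = i.hom)
    (H : (s ◁ (λ_ (𝟙_ C)).hom ≫ ((ρ_ s).hom ≫ e ≫ (λ_ s).inv ≫ i.inv ▷ s) ≫ k ▷ s) ≫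
        (α_ w w s).hom =
      (α_ s (𝟙_ C) (𝟙_ C)).inv ≫ ((ρ_ s).hom ≫ e ≫ (λ_ s).inv ≫ i.inv ▷ s) ▷ 𝟙_ C ≫
        (α_ w s (𝟙_ C)).hom ≫ w ◁ ((ρ_ s).hom ≫ e ≫ (λ_ s).inv ≫ i.inv ▷ s)) :
    e = e ≫ e := by
  have inv_comp : i.inv ≫ k = (λ_ (𝟙_ C)).inv ≫ (i.inv ⊗ₘ i.inv) := by
    rw [← cancel_mono ((i.hom ⊗ₘ i.hom) ≫ (λ_ (𝟙_ C)).hom), Category.assoc, hk]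
    simp
  have left : (s ◁ (λ_ (𝟙_ C)).hom ≫ ((ρ_ s).hom ≫ e ≫ (λ_ s).inv ≫ i.inv ▷ s) ≫ k ▷ s) ≫
      (α_ w w s).hom = ((α_ s (𝟙_ C) (𝟙_ C)).inv ≫ (ρ_ _).hom ≫ (ρ_ _).hom) ≫ e ≫
        (λ_ s).inv ≫ (λ_ _).inv ≫ i.inv ▷ _ ≫ w ◁ i.inv ▷ s := by
    simp only [Category.assoc, ← comp_whiskerRight_assoc, inv_comp, MonoidalCategory.tensorHom_def]
    monoidal
  have right : (α_ s (𝟙_ C) (𝟙_ C)).inv ≫ ((ρ_ s).hom ≫ e ≫ (λ_ s).inv ≫ i.inv ▷ s) ▷ 𝟙_ C ≫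
      (α_ w s (𝟙_ C)).hom ≫ w ◁ ((ρ_ s).hom ≫ e ≫ (λ_ s).inv ≫ i.inv ▷ s) =
      ((α_ s (𝟙_ C) (𝟙_ C)).inv ≫ (ρ_ _).hom ≫ (ρ_ _).hom) ≫ (e ≫ e) ≫
        (λ_ s).inv ≫ (λ_ _).inv ≫ i.inv ▷ _ ≫ w ◁ i.inv ▷ s := by
    simp only [comp_whiskerRight, MonoidalCategory.whiskerLeft_comp, Category.assoc,
      associator_naturality_left_assoc, ← whisker_exchange_assoc]
    monoidal
  rwa [left, right, cancel_epi, cancel_mono] at H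

/-- The exchange of the first two factors of a threefold product. -/
def exchange {a b a' b' : C} (e : a ⊗ b ≅ b' ⊗ a') (v : C) : a ⊗ b ⊗ v ≅ b' ⊗ a' ⊗ v :=
  (α_ a b v).symm ≪≫ whiskerRightIso e v ≪≫ α_ b' a' v

theorem exchange_naturality {a b a' b' : C} (e : a ⊗ b ≅ b' ⊗ a') {v v' : C} (f : v ⟶ v') :
    a ◁ b ◁ f ≫ (exchange e v').hom = (exchange e v).hom ≫ b' ◁ a' ◁ f := by
  simp only [exchange, Iso.trans_hom, Iso.symm_hom, whiskerRightIso_hom, Category.assoc]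
  rw [associator_inv_naturality_right_assoc, whisker_exchange_assoc, associator_naturality_right]

theorem exchange_yangBaxter {a b d b' d₁ d₁' d₂ : C} (bd : b ⊗ d ≅ d₁ ⊗ b)
    (ad₁ : a ⊗ d₁ ≅ d₂ ⊗ a) (ab : a ⊗ b ≅ b' ⊗ a) (ad : a ⊗ d ≅ d₁' ⊗ a)
    (bd₁' : b' ⊗ d₁' ≅ d₂ ⊗ b')
    (H : a ◁ bd.hom ≫ (α_ _ _ _).inv ≫ ad₁.hom ▷ b ≫ (α_ _ _ _).hom ≫ d₂ ◁ ab.hom =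
      (α_ _ _ _).inv ≫ ab.hom ▷ d ≫ (α_ _ _ _).hom ≫ b' ◁ ad.hom ≫ (α_ _ _ _).inv ≫
        bd₁'.hom ▷ a ≫ (α_ _ _ _).hom) (v : C) :
    a ◁ (exchange bd v).hom ≫ (exchange ad₁ (b ⊗ v)).hom ≫ d₂ ◁ (exchange ab v).hom =
      (exchange ab (d ⊗ v)).hom ≫ b' ◁ (exchange ad v).hom ≫ (exchange bd₁' (a ⊗ v)).hom := by
  simp only [exchange, Iso.trans_hom, Iso.symm_hom, whiskerRightIso_hom]
  calc
    _ = (a ◁ (α_ b d v).inv ≫ (α_ a (b ⊗ d) v).inv) ≫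
        (a ◁ bd.hom ≫ (α_ _ _ _).inv ≫ ad₁.hom ▷ b ≫ (α_ _ _ _).hom ≫ d₂ ◁ ab.hom) ▷ v ≫
        (α_ _ _ _).hom ≫ d₂ ◁ (α_ _ _ _).hom := by monoidal
    _ = _ := by rw [H]
    _ = _ := by monoidal

theorem whiskerRight_whiskerRight_associator {p q z b w w' : C} (f : p ⟶ q) (c : z ⊗ b ⟶ w ⊗ z)
    (e : w ⟶ w') :
    f ▷ z ▷ b ≫ (α_ q z b).hom ≫ q ◁ c ≫ q ◁ e ▷ z =
      (α_ p z b).hom ≫ p ◁ c ≫ (α_ p w z).inv ≫ (p ◁ e) ▷ z ≫ f ▷ w' ▷ z ≫ (α_ q w' z).hom := by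
  rw [associator_naturality_left_assoc, ← whisker_exchange_assoc, ← whisker_exchange]
  monoidal

end Monoidal

variable {G : Type*} [Group G] [CrossedBraidedCategory G C]

theorem beta_naturality_left (h : G) {s s' : C} (f : s ⟶ s') (t : C) :
    (act h).map f ▷ (act h).obj t ≫ (beta h s' t).hom = (beta h s t).hom ≫ (act h).map (f ▷ t) := by
  simpa using beta_naturality h f (𝟙 t)

theorem braid_naturality_left {s s' : C} (f : s ⟶ s') (t : C) {a : G} (ha : color s = a)
    (ha' : color s' = a) :
    f ▷ t ≫ (braid s' t ha').hom = (braid s t ha).hom ≫ (act a).obj t ◁ f := by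
  simpa using braid_naturality f (𝟙 t) ha ha'

theorem braid_naturality_right (s : C) {t t' : C} (f : t ⟶ t') {a : G} (ha : color s = a) :
    s ◁ f ≫ (braid s t' ha).hom = (braid s t ha).hom ≫ (act a).map f ▷ s := by
  simpa using braid_naturality (𝟙 s) f ha ha

section Unit

theorem whiskerRight_act_unit_injective (h : G) {s t : C} {f f' : s ⟶ t}
    (H : f ▷ (act h).obj (𝟙_ C) = f' ▷ (act h).obj (𝟙_ C)) : f = f' := by
  rw [← whiskerRight_iff, ← cancel_epi (s ◁ (eps h).hom), whisker_exchange, whisker_exchange, H]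

theorem gamma_eps {k h l : G} (hl : k * h = l) :
    (gamma hl (𝟙_ C)).hom ≫ (eps l).hom = (act k).map (eps h).hom ≫ (eps k).hom := by
  rw [← Iso.eq_inv_comp]
  refine whiskerRight_act_unit_injective l ?_
  rw [← cancel_mono (λ_ _).hom, eps_leftUnitor,
    ← cancel_epi ((gamma hl (𝟙_ C)).hom ⊗ₘ (gamma hl (𝟙_ C)).hom), reassoc_of% gamma_beta,
    ← gamma_naturality, ← Functor.map_comp_assoc, ← eps_leftUnitor, tensorHom_def_assoc,
    whisker_exchange_assoc, leftUnitor_naturality, ← comp_whiskerRight_assoc,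
    Iso.hom_inv_id_assoc, Functor.map_comp_assoc, ← reassoc_of% beta_naturality_left,
    ← reassoc_of% eps_leftUnitor, comp_whiskerRight, Category.assoc]

theorem eps_tensor_eps (h : G) :
    ((eps (C := C) h).hom ⊗ₘ (eps h).hom) ≫ (λ_ (𝟙_ C)).hom =
      (beta h (𝟙_ C) (𝟙_ C)).hom ≫ (act h).map (λ_ (𝟙_ C)).hom ≫ (eps h).hom := by
  rw [tensorHom_def_assoc, leftUnitor_naturality, reassoc_of% eps_leftUnitor]

/-- The hexagon at `𝟙_ C, 𝟙_ C, s`, together with `γ = [1]δ`, forces the conjugate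
`e : s ⟶ [1]s` of the braiding by unitors to satisfy `e = e ≫ δ ≫ e`. -/
theorem braid_unit_left (s : C) :
    (braid (𝟙_ C) s color_unit).hom = (λ_ s).hom ≫ (delta s).inv ≫ (ρ_ _).inv := by
  let e (u : C) : u ⟶ (act 1).obj u :=
    (λ_ u).inv ≫ (braid (𝟙_ C) u color_unit).hom ≫ (ρ_ _).hom
  have braid_eq (u : C) : (braid (𝟙_ C) u color_unit).hom = (λ_ u).hom ≫ e u ≫ (ρ_ _).inv := by
    simp [e]
  have e_naturality : e ((act 1).obj s) ≫ (act 1).map (delta s).hom = (delta s).hom ≫ e s := by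
    have := braid_naturality_right (𝟙_ C) (delta s).hom color_unit
    rw [braid_eq, braid_eq, leftUnitor_naturality_assoc] at this
    simpa using this.symm
  have delta_act : (delta ((act 1).obj s)).hom = (act 1).map (delta s).hom := by
    rw [← cancel_mono (delta s).hom, delta_naturality]
  have hexagon := braid_tensor_left s (color_unit (C := C)) color_unit
    ((color_tensor _ _).trans (by simp only [color_unit, mul_one])) (one_mul 1)
  have tensor_unit := braid_naturality_left (λ_ (𝟙_ C)).hom s
    ((color_tensor _ _).trans (by simp only [color_unit, mul_one])) color_unit
  rw [← whiskerLeftIso_hom, ← Iso.comp_inv_eq, whiskerLeftIso_inv, Category.assoc] at tensor_unit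
  rw [← tensor_unit, braid_eq, braid_eq] at hexagon
  have e_eq := eq_comp_of_unit_hexagon (e s) (e _) _ hexagon
  rw [gamma_one_left, delta_act, e_naturality] at e_eq
  have e_eq_inv : e s = (delta s).inv := by
    rw [← Iso.hom_comp_eq_id, ← cancel_epi (e s), ← e_eq, Category.comp_id]
  rw [braid_eq, e_eq_inv]

theorem braid_unit_right {s : C} {a : G} (ha : color s = a) :
    (braid s (𝟙_ C) ha).hom = (ρ_ s).hom ≫ (λ_ s).inv ≫ (eps a).inv ▷ s := by
  let e : s ⟶ s := (ρ_ s).inv ≫ (braid s (𝟙_ C) ha).hom ≫ (eps a).hom ▷ s ≫ (λ_ s).hom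
  have braid_eq : (braid s (𝟙_ C) ha).hom = (ρ_ s).hom ≫ e ≫ (λ_ s).inv ≫ (eps a).inv ▷ s := by
    simp [e]
  have hexagon := braid_tensor_right (𝟙_ C) (𝟙_ C) ha
  have tensor_unit := braid_naturality_right s (λ_ (𝟙_ C)).hom ha
  rw [← Functor.mapIso_hom, ← whiskerRightIso_hom, ← Iso.comp_inv_eq, whiskerRightIso_inv,
    Functor.mapIso_inv, Category.assoc] at tensor_unit
  rw [← tensor_unit, Category.assoc, Category.assoc, ← comp_whiskerRight_assoc, braid_eq]
    at hexagon
  have e_eq := eq_comp_self_of_unit_hexagon e (eps a)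
    ((act a).map (λ_ (𝟙_ C)).inv ≫ (beta a (𝟙_ C) (𝟙_ C)).inv)
    (by rw [Category.assoc, eps_tensor_eps, Iso.inv_hom_id_assoc, Iso.map_inv_hom_id_assoc])
    (by simpa only [Category.assoc] using hexagon)
  have e_eq_id : e = 𝟙 s := by rw [← cancel_epi e, ← e_eq, Category.comp_id]
  rw [braid_eq, e_eq_id, Category.id_comp]

end Unit

section Swap

/-- The braiding of `s` with `[k]t`, with the two labels in front of `t` multiplied. -/
def swap (s t : C) {a k l : G} (ha : color s = a) (hl : a * k = l) :
    s ⊗ (act k).obj t ≅ (act l).obj t ⊗ s :=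
  braid s _ ha ≪≫ whiskerRightIso (gamma hl t) s

theorem map_swap (s t : C) {h m k l m' k' l' a a' : G} (ha : color ((act m).obj s) = a)
    (ha' : color ((act m').obj s) = a') (hm : h * m = m') (hk : h * k = k') (hl : a * k = l)
    (hl' : a' * k' = l') (hhl : h * l = l') :
    (beta h _ _).hom ≫ (act h).map (swap ((act m).obj s) t ha hl).hom ≫ (beta h _ _).inv ≫
        ((gamma hhl t).hom ⊗ₘ (gamma hm s).hom) =
      ((gamma hm s).hom ⊗ₘ (gamma hk t).hom) ≫ (swap ((act m').obj s) t ha' hl').hom := by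
  have hb : color ((act h).obj ((act m).obj s)) = a' := by
    rw [← ha', ← hm]; simp only [color_act, mul_inv_rev, mul_assoc]
  have conj : a' * h = h * a := by rw [← hb, color_act, ha, inv_mul_cancel_right]
  have beta_gamma : (act h).map ((gamma hl t).hom ▷ _) ≫ (beta h _ ((act m).obj s)).inv =
      (beta h _ _).inv ≫ (act h).map (gamma hl t).hom ▷ _ := by
    rw [Iso.eq_inv_comp, ← Category.assoc, Iso.comp_inv_eq, ← beta_naturality_left]
  have gamma_left := gamma_gamma rfl hl (by rw [mul_assoc, hl, hhl]) hhl t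
  have gamma_right := gamma_gamma conj hk (by rw [mul_assoc, hl, hhl]) hl' t
  simp only [swap, Iso.trans_hom, whiskerRightIso_hom, Functor.map_comp, Category.assoc]
  rw [reassoc_of% beta_gamma, whiskerRight_comp_tensorHom, ← gamma_left,
    ← whiskerRight_comp_tensorHom, reassoc_of% beta_braid _ ha hb rfl conj,
    whiskerRight_comp_tensorHom, gamma_right, reassoc_of% braid_naturality,
    ← tensorHom_comp_whiskerRight]

theorem braid_tensor_right_eq {a : G} {s : C} (t u : C) (ha : color s = a) :
    (braid s (t ⊗ u) ha).hom = (α_ s t u).inv ≫ (braid s t ha).hom ▷ u ≫ (α_ _ s u).hom ≫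
      (act a).obj t ◁ (braid s u ha).hom ≫ (α_ _ _ s).inv ≫ (beta a t u).hom ▷ s := by
  rw [← cancel_mono ((beta a t u).inv ▷ s), ← cancel_mono (α_ _ _ s).hom, Category.assoc,
    braid_tensor_right]
  simp [← comp_whiskerRight]

theorem swap_yangBaxter (z s t : C) {m k a b k₁ k₂ m' k' b' : G} (ha : color z = a)
    (hb : color ((act m).obj s) = b) (hb' : color ((act m').obj s) = b') (h₁ : b * k = k₁)
    (h₂ : a * k₁ = k₂) (h₃ : a * m = m') (h₄ : a * k = k') (h₅ : b' * k' = k₂) :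
    z ◁ (swap ((act m).obj s) t hb h₁).hom ≫ (α_ _ _ _).inv ≫
        (swap z t ha h₂).hom ▷ (act m).obj s ≫ (α_ _ _ _).hom ≫
          (act k₂).obj t ◁ (swap z s ha h₃).hom =
      (α_ _ _ _).inv ≫ (swap z s ha h₃).hom ▷ (act k).obj t ≫ (α_ _ _ _).hom ≫
        (act m').obj s ◁ (swap z t ha h₄).hom ≫ (α_ _ _ _).inv ≫
          (swap ((act m').obj s) t hb' h₅).hom ▷ z ≫ (α_ _ _ _).hom := by
  have H := braid_naturality_right z (swap ((act m).obj s) t hb h₁).hom ha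
  rw [braid_tensor_right_eq, braid_tensor_right_eq, ← cancel_mono ((beta a _ _).inv ▷ z),
    ← cancel_mono (((gamma h₂ t).hom ⊗ₘ (gamma h₃ s).hom) ▷ z)] at H
  simp only [Category.assoc, ← comp_whiskerRight] at H
  rw [map_swap s t hb hb' h₃ h₄ h₁ h₅ h₂, Iso.hom_inv_id_assoc, ← cancel_mono (α_ _ _ _).hom] at H
  simp only [Category.assoc, comp_whiskerRight, tensorHom_def'] at H
  simp only [swap, Iso.trans_hom, whiskerRightIso_hom, comp_whiskerRight,
    MonoidalCategory.whiskerLeft_comp, Category.assoc] at H ⊢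
  rw [whiskerRight_whiskerRight_associator, reassoc_of% whiskerRight_whiskerRight_associator,
    Iso.hom_inv_id_assoc]
  exact H

end Swap

section Absorb

/-- Removes a unit labelled by `k` in front of `v`. -/
def absorbUnit (k : G) (v : C) : (act k).obj (𝟙_ C) ⊗ v ≅ v :=
  whiskerRightIso (eps k) v ≪≫ λ_ v

/-- Rewrites `[k][h]t` in front of `v`, given a way to rewrite `[l]t`, `l = k * h`. -/
def absorbAct {k h l : G} (hl : k * h = l) {t v n : C} (e : (act l).obj t ⊗ v ≅ n) :
    (act k).obj ((act h).obj t) ⊗ v ≅ n :=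
  whiskerRightIso (gamma hl t) v ≪≫ e

/-- Rewrites `[k](s ⊗ t)` in front of `v`, given ways to rewrite first `[k]t`, then `[k]s`. -/
def absorbTensor (k : G) {s t v n m : C} (e : (act k).obj t ⊗ v ≅ n)
    (e' : (act k).obj s ⊗ n ≅ m) : (act k).obj (s ⊗ t) ⊗ v ≅ m :=
  whiskerRightIso (beta k s t).symm v ≪≫ α_ _ _ _ ≪≫ whiskerLeftIso _ e ≪≫ e'

theorem absorbUnit_conj (k : G) {v v' : C} (q : v ⟶ v') :
    (absorbUnit k v).inv ≫ _ ◁ q ≫ (absorbUnit k v').hom = q := by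
  rw [Iso.inv_comp_eq]
  simp [absorbUnit, whisker_exchange_assoc]

theorem absorbAct_conj {k h l : G} (hl : k * h = l) {t v n v' n' : C}
    (e : (act l).obj t ⊗ v ≅ n) (e' : (act l).obj t ⊗ v' ≅ n') (q : v ⟶ v') :
    (absorbAct hl e).inv ≫ _ ◁ q ≫ (absorbAct hl e').hom = e.inv ≫ _ ◁ q ≫ e'.hom := by
  rw [Iso.inv_comp_eq]
  simp [absorbAct, whisker_exchange_assoc]

theorem absorbTensor_conj {k : G} {s t v n m v' n' m' : C} (e : (act k).obj t ⊗ v ≅ n)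
    (f : (act k).obj s ⊗ n ≅ m) (e' : (act k).obj t ⊗ v' ≅ n') (f' : (act k).obj s ⊗ n' ≅ m')
    (q : v ⟶ v') :
    (absorbTensor k e f).inv ≫ _ ◁ q ≫ (absorbTensor k e' f').hom =
      f.inv ≫ _ ◁ (e.inv ≫ _ ◁ q ≫ e'.hom) ≫ f'.hom := by
  rw [Iso.inv_comp_eq]
  simp [absorbTensor, whisker_exchange_assoc]

theorem absorbAct_conj_map {k h l : G} (hl : k * h = l) {t t' v n n' : C}
    (e : (act l).obj t ⊗ v ≅ n) (e' : (act l).obj t' ⊗ v ≅ n') (f : t ⟶ t') :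
    (absorbAct hl e).inv ≫ (act k).map ((act h).map f) ▷ v ≫ (absorbAct hl e').hom =
      e.inv ≫ (act l).map f ▷ v ≫ e'.hom := by
  rw [Iso.inv_comp_eq]
  simp only [absorbAct, Iso.trans_hom, whiskerRightIso_hom, ← comp_whiskerRight_assoc,
    gamma_naturality, Category.assoc, Iso.hom_inv_id_assoc]

theorem absorbTensor_conj_map {k : G} {s t s' t' v n m m₁ n' m' : C}
    (e : (act k).obj t ⊗ v ≅ n) (f : (act k).obj s ⊗ n ≅ m) (e' : (act k).obj t' ⊗ v ≅ n')
    (f₁ : (act k).obj s ⊗ n' ≅ m₁) (f' : (act k).obj s' ⊗ n' ≅ m') (x : s ⟶ s') (y : t ⟶ t') :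
    (absorbTensor k e f).inv ≫ (act k).map (x ⊗ₘ y) ▷ v ≫ (absorbTensor k e' f').hom =
      (f.inv ≫ _ ◁ (e.inv ≫ (act k).map y ▷ v ≫ e'.hom) ≫ f₁.hom) ≫
        f₁.inv ≫ (act k).map x ▷ n' ≫ f'.hom := by
  have beta_inv_naturality : (act k).map (x ⊗ₘ y) ≫ (beta k s' t').inv =
      (beta k s t).inv ≫ ((act k).map x ⊗ₘ (act k).map y) := by
    rw [Iso.comp_inv_eq, Category.assoc, beta_naturality, Iso.inv_hom_id_assoc]
  rw [Iso.inv_comp_eq]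
  simp only [absorbTensor, Iso.trans_hom, whiskerRightIso_hom, Iso.symm_hom, whiskerLeftIso_hom,
    ← comp_whiskerRight_assoc, beta_inv_naturality, Category.assoc, Iso.hom_inv_id_assoc]
  simp only [tensorHom_def', comp_whiskerRight, Category.assoc, MonoidalCategory.whiskerLeft_comp,
    associator_naturality_left_assoc, ← whisker_exchange_assoc, whiskerLeft_hom_inv_assoc]
  simp

theorem map_associator_absorbTensor {k : G} {s t u v n m l : C} (e : (act k).obj u ⊗ v ≅ n)
    (e' : (act k).obj t ⊗ n ≅ m) (e'' : (act k).obj s ⊗ m ≅ l) :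
    (act k).map (α_ s t u).hom ▷ v ≫ (absorbTensor k (absorbTensor k e e') e'').hom =
      (absorbTensor k e (absorbTensor k e' e'')).hom := by
  have beta_inv_assoc : (act k).map (α_ s t u).hom ≫ (beta k _ _).inv ≫ _ ◁ (beta k _ _).inv =
      (beta k _ _).inv ≫ (beta k _ _).inv ▷ _ ≫ (α_ _ _ _).hom := by
    rw [← cancel_mono (_ ◁ (beta k t u).hom ≫ (beta k s (t ⊗ u)).hom)]
    simp [← beta_assoc]
  calc
    _ = ((act k).map (α_ s t u).hom ≫ (beta k _ _).inv ≫ _ ◁ (beta k _ _).inv) ▷ v ≫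
          (α_ _ _ _).hom ≫ _ ◁ (α_ _ _ _).hom ≫ _ ◁ _ ◁ e.hom ≫ _ ◁ e'.hom ≫ e''.hom := by
      simp [absorbTensor]
    _ = _ := by rw [beta_inv_assoc]; simp [absorbTensor, whisker_exchange_assoc]

theorem map_leftUnitor_absorb {k : G} {s v n : C} (e : (act k).obj s ⊗ v ≅ n) :
    (act k).map (λ_ s).hom ▷ v ≫ e.hom = (absorbTensor k e (absorbUnit k n)).hom := by
  have : (act k).map (λ_ s).hom = (beta k _ _).inv ≫ (eps k).hom ▷ _ ≫ (λ_ _).hom := by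
    rw [Iso.eq_inv_comp, eps_leftUnitor]
  simp [this, absorbTensor, absorbUnit, whisker_exchange_assoc]

theorem map_rightUnitor_absorb {k : G} {s v n : C} (e : (act k).obj s ⊗ v ≅ n) :
    (act k).map (ρ_ s).hom ▷ v ≫ e.hom = (absorbTensor k (absorbUnit k v) e).hom := by
  have : (act k).map (ρ_ s).hom = (beta k _ _).inv ≫ _ ◁ (eps k).hom ≫ (ρ_ _).hom := by
    rw [Iso.eq_inv_comp, eps_rightUnitor]
  simp [this, absorbTensor, absorbUnit]

theorem map_beta_absorbAct {k h l : G} (hl : k * h = l) {s t v n m : C}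
    (e : (act l).obj t ⊗ v ≅ n) (e' : (act l).obj s ⊗ n ≅ m) :
    (act k).map (beta h s t).hom ▷ v ≫ (absorbAct hl (absorbTensor l e e')).hom =
      (absorbTensor k (absorbAct hl e) (absorbAct hl e')).hom := by
  have : (act k).map (beta h s t).hom ≫ (gamma hl _).hom ≫ (beta l s t).inv =
      (beta k _ _).inv ≫ ((gamma hl s).hom ⊗ₘ (gamma hl t).hom) := by
    rw [Iso.eq_inv_comp, ← reassoc_of% gamma_beta, Iso.hom_inv_id, Category.comp_id]
  simp only [absorbAct, absorbTensor, Iso.trans_hom, whiskerRightIso_hom, Iso.symm_hom,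
    whiskerLeftIso_hom, ← comp_whiskerRight_assoc, this]
  simp [tensorHom_def', whisker_exchange_assoc]

theorem map_gamma_absorbAct {h₃ h₂ h₁ k l m : G} (hk : h₃ * h₂ = k) (hl : h₂ * h₁ = l)
    (hm : k * h₁ = m) (hm' : h₃ * l = m) {s v n : C} (e : (act m).obj s ⊗ v ≅ n) :
    (act h₃).map (gamma hl s).hom ▷ v ≫ (absorbAct hm' e).hom =
      (absorbAct hk (absorbAct hm e)).hom := by
  simp only [absorbAct, Iso.trans_hom, whiskerRightIso_hom, ← comp_whiskerRight_assoc,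
    gamma_gamma hk hl hm hm']

theorem map_eps_absorbUnit (k h : G) (v : C) :
    (act k).map (eps h).hom ▷ v ≫ (absorbUnit k v).hom =
      (absorbAct rfl (absorbUnit (k * h) v)).hom := by
  simp only [absorbAct, absorbUnit, Iso.trans_hom, whiskerRightIso_hom, ← comp_whiskerRight_assoc,
    gamma_eps]

theorem absorb_braid {k h a b l m : G} {s t : C} (hm : k * h = m) (hl : k * a = l)
    (ha : color ((act h).obj s) = a) (hb : color ((act m).obj s) = b) (hbl : b * k = l) (v : C) :
    (absorbTensor k (Iso.refl _) (absorbAct hm (Iso.refl _))).inv ≫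
        (act k).map (braid ((act h).obj s) t ha).hom ▷ v ≫
          (absorbTensor k (absorbAct hm (Iso.refl _)) (absorbAct hl (Iso.refl _))).hom =
      (exchange (swap ((act m).obj s) t hb hbl) v).hom := by
  have hb' : color ((act k).obj ((act h).obj s)) = b := by
    rw [← hb, ← hm]; simp only [color_act, mul_inv_rev, mul_assoc]
  have braid_eq : (act k).map (braid ((act h).obj s) t ha).hom ≫ (beta k _ _).inv ≫
        ((gamma hl t).hom ⊗ₘ (gamma hm s).hom) =
      (beta k _ _).inv ≫ (gamma hm s).hom ▷ _ ≫ (swap ((act m).obj s) t hb hbl).hom := by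
    rw [swap, Iso.trans_hom, whiskerRightIso_hom,
      reassoc_of% braid_naturality_left (gamma hm s).hom _ hb' hb, whisker_exchange,
      Iso.eq_inv_comp, ← reassoc_of% beta_braid t ha hb' hl hbl, MonoidalCategory.tensorHom_def]
  rw [Iso.inv_comp_eq]
  calc
    _ = ((act k).map (braid ((act h).obj s) t ha).hom ≫ (beta k _ _).inv ≫
          ((gamma hl t).hom ⊗ₘ (gamma hm s).hom)) ▷ v ≫ (α_ _ _ _).hom := by
      simp [absorbTensor, absorbAct, tensorHom_def']
    _ = _ := by rw [braid_eq]; simp [absorbTensor, absorbAct, exchange]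

end Absorb

end CrossedBraidedCategory

end CrossedBraided

/-! ### Block braids -/

namespace BraidGroup

variable (r : ℕ)

/-- The `j`-th generator of the braid group on `r` strands; out of range the value is `1`, so that
positions can be natural numbers. -/
def gen (j : ℕ) : BraidGroup r :=
  if h : j < r - 1 then PresentedGroup.of ⟨j, h⟩ else 1

/-- The braid moving the strand at the position `p` over the next `m` strands. -/
def row (p : ℕ) : ℕ → BraidGroup r
  | 0 => 1
  | m + 1 => gen r (p + m) * row p m

/-- The braid moving the block of `n` strands from the position `p` on over the next `m` strands:
the braid underlying the braiding of operations with `n` and `m` inputs. -/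
def block : ℕ → ℕ → ℕ → BraidGroup r
  | _, 0, _ => 1
  | p, n + 1, m => row r p m * block (p + 1) n m

/-- The subgroup of the braids involving only the `n` strands from the position `p` on. -/
def strands (p n : ℕ) : Subgroup (BraidGroup r) :=
  Subgroup.closure {x | ∃ j, p ≤ j ∧ j + 1 < p + n ∧ gen r j = x}

variable {r}

theorem gen_of_lt {j : ℕ} (h : j < r - 1) : gen r j = PresentedGroup.of ⟨j, h⟩ :=
  dif_pos h

theorem gen_eq_of (j : Fin (r - 1)) : gen r j = PresentedGroup.of j :=
  gen_of_lt j.2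

@[elab_as_elim]
theorem induction_on {P : BraidGroup r → Prop} (b : BraidGroup r)
    (of : ∀ j : Fin (r - 1), P (PresentedGroup.of j)) (one : P 1)
    (mul : ∀ b b', P b → P b' → P (b * b')) (inv : ∀ b, P b → P b⁻¹) : P b := by
  have hb : b ∈ Subgroup.closure (Set.range PresentedGroup.of) := by
    rw [PresentedGroup.closure_range_of]
    trivial
  induction hb using Subgroup.closure_induction with
  | mem _ h => obtain ⟨j, rfl⟩ := h; exact of j
  | one => exact one
  | mul b b' _ _ h h' => exact mul b b' h h'
  | inv b _ h => exact inv b h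

theorem commute_gen_gen {i j : ℕ} (h : i + 2 ≤ j) : Commute (gen r i) (gen r j) := by
  unfold gen
  split_ifs with hi hj
  · have := PresentedGroup.one_of_mem (rels := {w | BraidRel r w}) (BraidRel.far ⟨i, hi⟩ ⟨j, hj⟩ h)
    rwa [map_mul, map_inv, mul_inv_eq_one, map_mul, map_mul] at this
  all_goals simp

theorem gen_braid {j : ℕ} (h : j + 2 < r) :
    gen r j * gen r (j + 1) * gen r j = gen r (j + 1) * gen r j * gen r (j + 1) := by
  rw [gen_of_lt (by omega : j < r - 1), gen_of_lt (by omega : j + 1 < r - 1)]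
  have := PresentedGroup.one_of_mem (rels := {w | BraidRel r w})
    (BraidRel.braid ⟨j, by omega⟩ ⟨j + 1, by omega⟩ rfl)
  rwa [map_mul, map_inv, mul_inv_eq_one, map_mul, map_mul, map_mul, map_mul] at this

theorem gen_mem_strands {p n j : ℕ} (h : p ≤ j) (h' : j + 1 < p + n) : gen r j ∈ strands r p n :=
  Subgroup.subset_closure ⟨j, h, h', rfl⟩

theorem strands_mono {p n p' n' : ℕ} (h : p' ≤ p) (h' : p + n ≤ p' + n') :
    strands r p n ≤ strands r p' n' := by
  rw [strands, Subgroup.closure_le]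
  rintro _ ⟨j, hj, hj', rfl⟩
  exact gen_mem_strands (by omega) (by omega)

theorem commute_of_mem_strands {p n q m : ℕ} (h : p + n ≤ q) {x y : BraidGroup r}
    (hx : x ∈ strands r p n) (hy : y ∈ strands r q m) : Commute x y := by
  have : strands r p n ≤ Subgroup.centralizer (strands r q m) := by
    rw [strands, strands, Subgroup.centralizer_closure, Subgroup.closure_le]
    rintro _ ⟨j, _, hj', rfl⟩
    rw [SetLike.mem_coe, Subgroup.mem_centralizer_iff]
    rintro _ ⟨i, hi, _, rfl⟩
    exact (commute_gen_gen (by omega)).symm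
  exact (Subgroup.mem_centralizer_iff.1 (this hx) y hy).symm

theorem row_mem_strands (p m : ℕ) : row r p m ∈ strands r p (m + 1) := by
  induction m with
  | zero => exact one_mem _
  | succ m ih =>
    exact mul_mem (gen_mem_strands (by omega) (by omega)) (strands_mono le_rfl (by omega) ih)

theorem block_mem_strands (p n m : ℕ) : block r p n m ∈ strands r p (n + m) := by
  induction n generalizing p with
  | zero => exact one_mem _
  | succ n ih =>
    exact mul_mem (strands_mono le_rfl (by omega) (row_mem_strands p m))
      (strands_mono (by omega) (by omega) (ih (p + 1)))

@[simp]
theorem block_zero_left (p m : ℕ) : block r p 0 m = 1 := rfl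

@[simp]
theorem block_one_one (p : ℕ) : block r p 1 1 = gen r p := by
  simp [block, row]

theorem row_add (p m m' : ℕ) : row r p (m + m') = row r (p + m) m' * row r p m := by
  induction m' with
  | zero => simp [row]
  | succ m' ih => rw [← add_assoc, row, row, ih, mul_assoc, add_assoc]

theorem block_add_left (p n n' m : ℕ) :
    block r p (n + n') m = block r p n m * block r (p + n) n' m := by
  induction n generalizing p with
  | zero => simp
  | succ n ih =>
    rw [add_right_comm, block, block, ih, mul_assoc, add_right_comm, add_assoc p n 1]

theorem block_add_right (p n m m' : ℕ) :
    block r p n (m + m') = block r (p + m) n m' * block r p n m := by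
  induction n generalizing p with
  | zero => simp
  | succ n ih =>
    have h : Commute (row r p m) (block r (p + 1 + m) n m') :=
      commute_of_mem_strands (by omega) (row_mem_strands p m) (block_mem_strands _ _ _)
    rw [block, block, block, ih, row_add, mul_assoc, h.left_comm, mul_assoc, add_right_comm]

@[simp]
theorem block_zero_right (p n : ℕ) : block r p n 0 = 1 := by
  simpa using block_add_right (r := r) p n 0 0

theorem commute_row_gen {p m j : ℕ} (h : p + m + 1 ≤ j) : Commute (row r p m) (gen r j) :=
  commute_of_mem_strands (q := j) (m := 2) (by omega) (row_mem_strands p m)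
    (gen_mem_strands le_rfl (by omega))

theorem row_semiconjBy_gen {p m j : ℕ} (h : p ≤ j) (h' : j + 1 < p + m) (hr : p + m < r) :
    SemiconjBy (row r p m) (gen r (j + 1)) (gen r j) := by
  induction m with
  | zero => omega
  | succ m ih =>
    rcases Nat.lt_or_ge (j + 1) (p + m) with hj | hj
    · exact SemiconjBy.mul_left (commute_gen_gen (by omega)).symm (ih hj (by omega))
    · obtain ⟨m, rfl⟩ : ∃ k, m = k + 1 := ⟨m - 1, by omega⟩
      obtain rfl : j = p + m := by omega
      rw [row, row, ← mul_assoc, ← add_assoc]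
      refine SemiconjBy.mul_left ?_ (commute_row_gen le_rfl)
      rw [SemiconjBy, ← gen_braid (by omega), mul_assoc]

theorem row_mul_row_semiconjBy_gen {p m : ℕ} (hr : p + m + 1 < r) :
    SemiconjBy (row r p m * row r (p + 1) m) (gen r p) (gen r (p + m)) := by
  induction m with
  | zero => simp [row]
  | succ m ih =>
    have factor : row r p (m + 1) * row r (p + 1) (m + 1) =
        gen r (p + m) * gen r (p + m + 1) * (row r p m * row r (p + 1) m) := by
      rw [row, row, add_right_comm p 1 m, mul_assoc, (commute_row_gen le_rfl).left_comm,
        ← mul_assoc]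
    rw [factor, ← add_assoc]
    refine SemiconjBy.mul_left ?_ (ih (by omega))
    rw [SemiconjBy, gen_braid (by omega), mul_assoc]

theorem block_semiconjBy_gen_right {p n m j : ℕ} (h : p ≤ j) (h' : j + 1 < p + m)
    (hr : p + n + m ≤ r) : SemiconjBy (block r p n m) (gen r (j + n)) (gen r j) := by
  induction n generalizing p j with
  | zero => simp
  | succ n ih =>
    rw [block, ← add_assoc, add_right_comm]
    exact (row_semiconjBy_gen h h' (by omega)).mul_left (ih (by omega) (by omega) (by omega))

theorem block_semiconjBy_gen_left {p n m j : ℕ} (h : p ≤ j) (h' : j + 1 < p + n)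
    (hr : p + n + m ≤ r) : SemiconjBy (block r p n m) (gen r j) (gen r (j + m)) := by
  induction n generalizing p j with
  | zero => omega
  | succ n ih =>
    rcases Nat.lt_or_ge p j with hj | hj
    · exact SemiconjBy.mul_left (commute_row_gen (by omega)) (ih hj (by omega) (by omega))
    · obtain rfl : j = p := by omega
      obtain ⟨n, rfl⟩ : ∃ k, n = k + 1 := ⟨n - 1, by omega⟩
      have gen_block : Commute (block r (j + 1 + 1) n m) (gen r j) :=
        (commute_of_mem_strands (p := j) (n := 2) (by omega)
          (gen_mem_strands le_rfl (by omega)) (block_mem_strands _ _ _)).symm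
      rw [block, block, ← mul_assoc]
      exact (row_mul_row_semiconjBy_gen (by omega)).mul_left gen_block

theorem semiconjBy_row {p q m : ℕ} {y : BraidGroup r}
    (h : ∀ j, j < m → SemiconjBy y (gen r (p + j)) (gen r (q + j))) :
    SemiconjBy y (row r p m) (row r q m) := by
  induction m with
  | zero => exact SemiconjBy.one_right y
  | succ m ih => exact (h m (by omega)).mul_right (ih fun j hj => h j (by omega))

theorem semiconjBy_block {p q n m : ℕ} {y : BraidGroup r}
    (h : ∀ j, j + 1 < n + m → SemiconjBy y (gen r (p + j)) (gen r (q + j))) :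
    SemiconjBy y (block r p n m) (block r q n m) := by
  induction n generalizing p q with
  | zero => exact SemiconjBy.one_right y
  | succ n ih =>
    refine (semiconjBy_row fun j hj => h j (by omega)).mul_right (ih fun j hj => ?_)
    rw [add_assoc, add_assoc]
    exact h (1 + j) (by omega)

end BraidGroup

/-! ### The braid of a formal morphism -/

section ToBraid

open GTree PreHom BraidGroup

/-- The number of inputs of the operation given by a tree. -/
def GTree.size {G : Type u} {X : Type v} (t : GTree G X) : ℕ := t.leaves.length

section Size

variable {G : Type u} {X : Type v}

@[simp] theorem GTree.size_leaf (x : X) : (leaf x : GTree G X).size = 1 := rfl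

@[simp] theorem GTree.size_unit : (unit : GTree G X).size = 0 := rfl

@[simp] theorem GTree.size_act (h : G) (t : GTree G X) : (act h t).size = t.size := rfl

@[simp] theorem GTree.size_mul (s t : GTree G X) : (mul s t).size = s.size + t.size :=
  List.length_append

end Size

variable {G : Type u} [Group G] {X : Type v} {g : X → G}

theorem PreHom.size_eq {s t : GTree G X} (f : PreHom g s t) : s.size = t.size := by
  induction f with
  | comp _ _ ih ih' => exact ih.trans ih'
  | inv _ ih => exact ih.symm
  | actMap _ _ ih => exact ih
  | mulMap _ _ ih ih' => simp only [size_mul, ih, ih']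
  | _ => simp [add_assoc, add_comm]

/-- The braid on `r` strands underlying a formal morphism between trees whose leaves are placed at
the positions from `p` on. -/
def PreHom.toBraid (r : ℕ) : ∀ {s t : GTree G X}, ℕ → PreHom g s t → BraidGroup r
  | _, _, _, .id _ => 1
  | _, _, p, .comp f f' => f'.toBraid r p * f.toBraid r p
  | _, _, p, .inv f => (f.toBraid r p)⁻¹
  | _, _, p, .actMap _ f => f.toBraid r p
  | _, _, p, .mulMap (s := s) f f' => f.toBraid r p * f'.toBraid r (p + s.size)
  | _, _, p, .braid s t _ _ => block r p s.size t.size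
  | _, _, _, .alpha _ _ _ => 1
  | _, _, _, .ell _ => 1
  | _, _, _, .rho _ => 1
  | _, _, _, .beta _ _ _ => 1
  | _, _, _, .gamma _ _ _ _ _ => 1
  | _, _, _, .delta _ => 1
  | _, _, _, .eps _ => 1

variable {r : ℕ}

theorem PreHom.toBraid_mem_strands (p : ℕ) {s t : GTree G X} (f : PreHom g s t) :
    f.toBraid r p ∈ strands r p s.size := by
  induction f generalizing p with
  | comp f f' ih ih' => exact mul_mem (f.size_eq ▸ ih' p) (ih p)
  | inv f ih => exact inv_mem (f.size_eq ▸ ih p)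
  | actMap _ _ ih => exact ih p
  | mulMap f f' ih ih' =>
    exact mul_mem (strands_mono le_rfl (by simp) (ih p))
      (strands_mono (by omega) (by simp [add_assoc]) (ih' _))
  | braid s t => exact size_mul s t ▸ block_mem_strands _ _ _
  | _ => exact one_mem _

theorem PreHom.semiconjBy_toBraid {s t : GTree G X} (f : PreHom g s t) {p q : ℕ}
    {y : BraidGroup r}
    (h : ∀ j, j + 1 < s.size → SemiconjBy y (gen r (p + j)) (gen r (q + j))) :
    SemiconjBy y (f.toBraid r p) (f.toBraid r q) := by
  induction f generalizing p q with
  | comp f f' ih ih' => exact (ih' (f.size_eq ▸ h)).mul_right (ih h)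
  | inv f ih => exact (ih (f.size_eq ▸ h)).inv_right
  | actMap _ _ ih => exact ih h
  | @mulMap s _ _ _ f f' ih ih' =>
    simp only [size_mul] at h
    refine (ih fun j hj => h j (by omega)).mul_right (ih' fun j hj => ?_)
    rw [add_assoc, add_assoc]
    exact h (s.size + j) (by omega)
  | braid s t => exact semiconjBy_block (size_mul s t ▸ h)
  | _ => exact SemiconjBy.one_right y

theorem PreHom.toBraid_braid_naturality {s s' t t' : GTree G X} (f : PreHom g s s')
    (f' : PreHom g t t') {p : ℕ} (hp : p + s.size + t.size ≤ r) :
    block r p s.size t.size * (f.toBraid r p * f'.toBraid r (p + s.size)) =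
      f'.toBraid r p * f.toBraid r (p + t.size) * block r p s.size t.size := by
  have left : SemiconjBy (block r p s.size t.size) (f.toBraid r p) (f.toBraid r (p + t.size)) :=
    f.semiconjBy_toBraid fun j hj => by
      rw [add_right_comm]
      exact block_semiconjBy_gen_left (by omega) (by omega) (by omega)
  have right : SemiconjBy (block r p s.size t.size) (f'.toBraid r (p + s.size))
      (f'.toBraid r p) :=
    f'.semiconjBy_toBraid fun j hj => by
      rw [add_right_comm]
      exact block_semiconjBy_gen_right (by omega) (by omega) (by omega)
  rw [(left.mul_right right).eq,
    (commute_of_mem_strands le_rfl (f'.toBraid_mem_strands p) (f.toBraid_mem_strands _)).eq]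

theorem Rel.toBraid_eq {s t : GTree G X} {f f' : PreHom g s t} (hf : Rel g f f') {p : ℕ}
    (hp : p + s.size ≤ r) : f.toBraid r p = f'.toBraid r p := by
  induction hf generalizing p with
  | symm _ ih => exact (ih hp).symm
  | trans _ _ ih ih' => exact (ih hp).trans (ih' hp)
  | @comp_congr _ _ _ f _ _ _ _ _ ih ih' =>
    exact congrArg₂ (· * ·) (ih' (f.size_eq ▸ hp)) (ih hp)
  | @inv_congr _ _ f _ _ ih => exact congrArg (·⁻¹) (ih (f.size_eq ▸ hp))
  | act_congr _ _ ih => exact ih hp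
  | mul_congr _ _ ih ih' =>
    simp only [size_mul] at hp
    exact congrArg₂ (· * ·) (ih (by omega)) (ih' (by omega))
  | @mul_comp _ _ _ _ _ _ f k f' k' =>
    have h : Commute (f.toBraid r p) (k'.toBraid r _) :=
      commute_of_mem_strands le_rfl (f.toBraid_mem_strands p) (k'.toBraid_mem_strands _)
    simp only [toBraid]
    rw [← f.size_eq, mul_assoc, mul_assoc, h.left_comm]
  | braid_nat f f' =>
    rw [size_mul] at hp
    simp only [toBraid, size_act]
    rw [← f.size_eq, ← f'.size_eq]
    exact toBraid_braid_naturality f f' (by omega)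
  | alpha_nat => simp [toBraid, mul_assoc, add_assoc]
  | G10_right => simp [toBraid, block_add_left]
  | G10_left => simp [toBraid, block_add_right]
  | _ => simp [toBraid, mul_assoc]

end ToBraid

/-! ### Words -/

section Word

variable {G : Type*} [Group G] {X : Type*} (g : X → G)

/-- The colour of the letter `(k, x)`, the input `x` labelled by `k`, when the inputs have the
colours `g`. -/
def letterColor (a : G × X) : G :=
  a.1 * g a.2 * a.1⁻¹

/-- The generator `c_{j, j+1}` acting on words: the letter at `j + 1` moves in front of the letter
at `j`, whose colour multiplies its label. Out of range nothing happens. -/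
def wordStep : ℕ → List (G × X) → List (G × X)
  | 0, a :: b :: w => (letterColor g a * b.1, b.2) :: a :: w
  | j + 1, a :: w => a :: wordStep j w
  | _, w => w

/-- The inverse of `wordStep`. -/
def wordStepInv : ℕ → List (G × X) → List (G × X)
  | 0, a :: b :: w => b :: ((letterColor g b)⁻¹ * a.1, a.2) :: w
  | j + 1, a :: w => a :: wordStepInv j w
  | _, w => w

theorem wordStep_leftInverse (j : ℕ) :
    Function.LeftInverse (wordStepInv g j) (wordStep g j) := by
  intro w
  fun_induction wordStep g j w with
  | case1 => simp [wordStepInv]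
  | case2 j a w ih => simp [wordStepInv, ih]
  | case3 j w _ _ => rcases j with _ | j <;> rcases w with _ | ⟨a, _ | ⟨b, w⟩⟩ <;>
      simp_all [wordStepInv]

theorem wordStep_rightInverse (j : ℕ) :
    Function.RightInverse (wordStepInv g j) (wordStep g j) := by
  intro w
  fun_induction wordStepInv g j w with
  | case1 => simp [wordStep]
  | case2 j a w ih => simp [wordStep, ih]
  | case3 j w _ _ => rcases j with _ | j <;> rcases w with _ | ⟨a, _ | ⟨b, w⟩⟩ <;>
      simp_all [wordStep]

@[simp]
theorem length_wordStep (j : ℕ) (w : List (G × X)) : (wordStep g j w).length = w.length := by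
  fun_induction wordStep g j w <;> simp_all

end Word

section PointedWord

open MonoidalCategory CrossedBraidedCategory BraidGroup

variable {G : Type*} [Group G] {C : Type*} [Category* C] [MonoidalCategory C]
  [CrossedBraidedCategory G C] {X : Type*} (L : X → C)

/-- The object `[k](L x)` given by the letter `(k, x)`. -/
def letterObj (a : G × X) : C :=
  (act a.1).obj (L a.2)

/-- The product of the letters of a word, associated to the right. -/
def wordObj : List (G × X) → C
  | [] => 𝟙_ C
  | a :: w => letterObj L a ⊗ wordObj w

/-- The crossing of the letters at `j` and `j + 1`. -/
def cross : ∀ (j : ℕ) (w : List (G × X)),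
    wordObj L w ≅ wordObj L (wordStep (fun x => color (L x)) j w)
  | 0, a :: b :: w => exchange (swap (letterObj L a) (L b.2) (color_act _ _) rfl) (wordObj L w)
  | j + 1, a :: w => whiskerLeftIso (letterObj L a) (cross j w)
  | 0, [] => Iso.refl _
  | 0, [_] => Iso.refl _
  | _ + 1, [] => Iso.refl _

/-- A word of length `r` with a morphism from `o` to its product. The braid group acts on these
rather than on morphisms, since a braid changes the word. -/
structure PointedWord (o : C) (r : ℕ) where
  word : List (G × X)
  length_eq : word.length = r
  hom : o ⟶ wordObj L word

namespace PointedWord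

variable {L} {o o' : C} {r : ℕ}

/-- The word `w` with the identity morphism. -/
def ofWord (w : List (G × X)) (hw : w.length = r) : PointedWord L (wordObj L w) r :=
  ⟨w, hw, 𝟙 _⟩

/-- The action of the `j`-th generator of the braid group. -/
def step (j : ℕ) (e : PointedWord L o r) : PointedWord L o r :=
  ⟨wordStep _ j e.word, (length_wordStep _ j e.word).trans e.length_eq,
    e.hom ≫ (cross L j e.word).hom⟩

/-- Precomposition with a morphism. -/
def pre (φ : o ⟶ o') (e : PointedWord L o' r) : PointedWord L o r :=
  ⟨e.word, e.length_eq, φ ≫ e.hom⟩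

/-- A further letter in front. -/
def cons (a : G × X) {v : List (G × X)} (e : PointedWord L (wordObj L v) r) :
    PointedWord L (wordObj L (a :: v)) (r + 1) :=
  ⟨a :: e.word, congrArg (· + 1) e.length_eq, letterObj L a ◁ e.hom⟩

theorem mk_congr {w : List (G × X)} {hw : w.length = r} {φ φ' : o ⟶ wordObj L w} (h : φ = φ') :
    (⟨w, hw, φ⟩ : PointedWord L o r) = ⟨w, hw, φ'⟩ := by
  rw [h]

theorem pre_ofWord (e : PointedWord L o r) : pre e.hom (ofWord e.word e.length_eq) = e :=
  mk_congr (Category.comp_id _)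

theorem cons_ofWord (a : G × X) (w : List (G × X)) (hw : w.length = r) :
    cons a (ofWord (L := L) w hw) = ofWord (a :: w) (congrArg (· + 1) hw) :=
  mk_congr (whiskerLeft_id _ _)

theorem step_pre (j : ℕ) (φ : o ⟶ o') (e : PointedWord L o' r) :
    step j (pre φ e) = pre φ (step j e) :=
  mk_congr (Category.assoc _ _ _)

theorem step_cons (j : ℕ) (a : G × X) {v : List (G × X)} (e : PointedWord L (wordObj L v) r) :
    step (j + 1) (cons a e) = cons a (step j e) :=
  mk_congr (MonoidalCategory.whiskerLeft_comp _ _ _).symm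

theorem step_bijective (j : ℕ) : Function.Bijective (step (L := L) (o := o) (r := r) j) := by
  constructor
  · rintro ⟨w, hw, φ⟩ ⟨w', hw', φ'⟩ h
    obtain rfl : w = w' := (wordStep_leftInverse _ j).injective (congrArg word h)
    exact mk_congr ((cancel_mono (cross L j w).hom).1 (by simpa [step] using h))
  · rintro ⟨w, hw, φ⟩
    obtain ⟨w, rfl⟩ := (wordStep_rightInverse (fun x => color (L x)) j).surjective w
    exact ⟨⟨w, by simpa using hw, φ ≫ (cross L j w).inv⟩, by simp [step]⟩

theorem step_zero_step_add_two_ofWord (j : ℕ) (a b : G × X) (w : List (G × X))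
    (hw : (a :: b :: w).length = r) :
    step 0 (step (j + 2) (ofWord (L := L) (a :: b :: w) hw)) =
      step (j + 2) (step 0 (ofWord (a :: b :: w) hw)) := by
  refine mk_congr ?_
  simp only [ofWord, Category.id_comp, step]
  exact exchange_naturality _ _

theorem step_step_comm {i j : ℕ} (hij : i + 2 ≤ j) (hj : j + 1 < r) (e : PointedWord L o r) :
    step i (step j e) = step j (step i e) := by
  suffices ∀ w hw, step i (step j (ofWord (L := L) (r := r) w hw)) =
      step j (step i (ofWord w hw)) by
    rw [← pre_ofWord e, step_pre, step_pre, step_pre, step_pre, this]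
  clear e
  intro w hw
  induction i generalizing j r w with
  | zero =>
    obtain ⟨j, rfl⟩ := Nat.exists_eq_add_of_le' hij
    match w, hw with
    | a :: b :: w, hw => exact step_zero_step_add_two_ofWord j a b w hw
    | [], hw | [_], hw => simp at hw; omega
  | succ i ih =>
    obtain ⟨j, rfl⟩ := Nat.exists_eq_add_of_le' (by omega : 1 ≤ j)
    match w, r, hw with
    | a :: w, r + 1, hw =>
      rw [← cons_ofWord a w (Nat.succ.inj hw), step_cons, step_cons, step_cons, step_cons,
        ih (by omega) (by omega)]
    | [], _, rfl => simp at hj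

theorem step_zero_one_zero_ofWord (a b d : G × X) (w : List (G × X))
    (hw : (a :: b :: d :: w).length = r) :
    step 0 (step 1 (step 0 (ofWord (L := L) (a :: b :: d :: w) hw))) =
      step 1 (step 0 (step 1 (ofWord (a :: b :: d :: w) hw))) := by
  let κ (x : X) : G := color (L x)
  let b' : G × X := (letterColor κ a * b.1, b.2)
  have color_eq (a : G × X) : color (letterObj L a) = letterColor κ a := color_act _ _
  have label_eq : letterColor κ b' * (letterColor κ a * d.1) =
      letterColor κ a * (letterColor κ b * d.1) := by
    simp [b', letterColor, mul_assoc]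
  have of_eq (k) (hk : letterColor κ b' * (letterColor κ a * d.1) = k)
      (hk' : letterColor κ a * (letterColor κ b * d.1) = k) (hw') (hw'') :
      (⟨(letterColor κ b' * (letterColor κ a * d.1), d.2) :: b' :: a :: w, hw',
        (exchange (swap (letterObj L a) (L b.2) (color_eq a) rfl) _).hom ≫
          letterObj L b' ◁ (exchange (swap (letterObj L a) (L d.2) (color_eq a) rfl) _).hom ≫
            (exchange (swap (letterObj L b') (L d.2) (color_eq b') rfl) _).hom⟩ :
        PointedWord L (wordObj L (a :: b :: d :: w)) r) =
      ⟨(k, d.2) :: b' :: a :: w, hw'',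
        letterObj L a ◁ (exchange (swap (letterObj L b) (L d.2) (color_eq b) rfl) _).hom ≫
          (exchange (swap (letterObj L a) (L d.2) (color_eq a) hk') _).hom ≫
            letterObj L (k, d.2) ◁
              (exchange (swap (letterObj L a) (L b.2) (color_eq a) rfl) (wordObj L w)).hom⟩ := by
    subst hk
    exact mk_congr (exchange_yangBaxter _ _ _ _ _ (swap_yangBaxter ..) _).symm
  refine Eq.trans (mk_congr ?_) ((of_eq _ label_eq rfl _ _).trans (mk_congr ?_))
  all_goals simp only [ofWord, Category.id_comp, step, Category.assoc]; rfl

theorem step_braid {j : ℕ} (hj : j + 2 < r) (e : PointedWord L o r) :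
    step j (step (j + 1) (step j e)) = step (j + 1) (step j (step (j + 1) e)) := by
  suffices ∀ w hw, step j (step (j + 1) (step j (ofWord (L := L) (r := r) w hw))) =
      step (j + 1) (step j (step (j + 1) (ofWord w hw))) by
    rw [← pre_ofWord e]
    simp only [step_pre, this]
  clear e
  intro w hw
  induction j generalizing r w with
  | zero =>
    match w, hw with
    | a :: b :: d :: w, hw => exact step_zero_one_zero_ofWord a b d w hw
    | [], hw | [_], hw | [_, _], hw => simp at hw; omega
  | succ j ih =>
    match w, r, hw with
    | a :: w, r + 1, hw =>
      rw [← cons_ofWord a w (Nat.succ.inj hw)]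
      simp only [step_cons, ih (by omega : j + 2 < r)]
    | [], _, rfl => simp at hj

variable (L o r) in
/-- The action of the braid group on the pointed words of length `r`. -/
noncomputable def braidAction : BraidGroup r →* Equiv.Perm (PointedWord L o r) :=
  PresentedGroup.toGroup (rels := {w | BraidRel r w})
    (f := fun j : Fin (r - 1) => Equiv.ofBijective _ (step_bijective j)) (by
      rintro _ (⟨i, j, hij⟩ | ⟨i, j, hij⟩) <;>
        simp only [map_mul, map_inv, FreeGroup.lift_apply_of, mul_inv_eq_one]
      · exact Equiv.ext fun e => step_step_comm hij (Nat.add_lt_of_lt_sub j.2) e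
      · refine Equiv.ext fun e => ?_
        have hi : (i : ℕ) + 2 < r := by omega
        rw [← hij]
        exact step_braid hi e)

noncomputable instance : MulAction (BraidGroup r) (PointedWord L o r) :=
  MulAction.compHom _ (braidAction L o r)

theorem gen_smul {j : ℕ} (hj : j + 1 < r) (e : PointedWord L o r) : gen r j • e = step j e := by
  change braidAction L o r (gen r j) e = step j e
  rw [gen_of_lt (by omega), braidAction, PresentedGroup.toGroup.of]
  rfl

end PointedWord

/-- The morphism `q` behind the letters of `u`, which are put in front one by one: `reverseAux`
instead of `++` makes the types agree definitionally. -/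
def lift : ∀ (u : List (G × X)) {w w' : List (G × X)}, (wordObj L w ⟶ wordObj L w') →
    (wordObj L (u.reverseAux w) ⟶ wordObj L (u.reverseAux w'))
  | [], _, _, q => q
  | a :: u, w, w', q => lift u (w := a :: w) (w' := a :: w') (letterObj L a ◁ q)

variable {L}

theorem lift_id (u w : List (G × X)) : lift L u (𝟙 (wordObj L w)) = 𝟙 _ := by
  induction u generalizing w with
  | nil => rfl
  | cons a u ih => exact (congrArg (lift L u) (whiskerLeft_id _ _)).trans (ih (a :: w))

theorem lift_comp (u : List (G × X)) {w w' w'' : List (G × X)} (q : wordObj L w ⟶ wordObj L w')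
    (q' : wordObj L w' ⟶ wordObj L w'') : lift L u (q ≫ q') = lift L u q ≫ lift L u q' := by
  induction u generalizing w w' w'' with
  | nil => rfl
  | cons a u ih =>
    exact (congrArg (lift L u) (MonoidalCategory.whiskerLeft_comp _ _ _)).trans (ih _ _)

theorem step_lift (u : List (G × X)) (j : ℕ) (w : List (G × X)) {o : C} {r : ℕ}
    (φ : o ⟶ wordObj L (u.reverseAux w)) (hw : (u.reverseAux w).length = r)
    (hw' : (u.reverseAux (wordStep _ j w)).length = r) :
    PointedWord.step (u.length + j) ⟨u.reverseAux w, hw, φ⟩ =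
      ⟨u.reverseAux (wordStep _ j w), hw', φ ≫ lift L u (cross L j w).hom⟩ := by
  induction u generalizing j w with
  | nil => simp only [List.length_nil, zero_add]; rfl
  | cons a u ih =>
    rw [List.length_cons, add_assoc, add_comm 1]
    exact ih (j + 1) (a :: w) φ _ _

/-- The morphism `q`, at the positions from `p` on, acts as the braid `b`. -/
structure Realizes {r : ℕ} (p : ℕ) (b : BraidGroup r) {w w' : List (G × X)}
    (q : wordObj L w ⟶ wordObj L w') : Prop where
  length_eq : w.length = w'.length
  smul_eq (u : List (G × X)) (hu : u.length = p) {o : C} (φ : o ⟶ wordObj L (u.reverseAux w))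
      (hw hw') :
    b • (⟨u.reverseAux w, hw, φ⟩ : PointedWord L o r) =
      ⟨u.reverseAux w', hw', φ ≫ lift L u q⟩

namespace Realizes

open PointedWord

variable {r p : ℕ} {b b' : BraidGroup r} {w w' w'' : List (G × X)}

theorem id (w : List (G × X)) : Realizes p (1 : BraidGroup r) (𝟙 (wordObj L w)) where
  length_eq := rfl
  smul_eq u _ o φ _ _ := by simp only [one_smul, lift_id, Category.comp_id]

theorem of_pointedWord_eq {o : C} {φ : o ⟶ wordObj L w} [Epi φ] {q : wordObj L w ⟶ wordObj L w'}
    {n : ℕ} {hw : w.length = n} {hw' : w'.length = n}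
    (h : (⟨w, hw, φ⟩ : PointedWord L o n) = ⟨w', hw', φ ≫ q⟩) :
    Realizes p (1 : BraidGroup r) q := by
  obtain rfl : w = w' := congrArg word h
  obtain rfl : 𝟙 _ = q := by
    rw [← cancel_epi φ, Category.comp_id]
    simpa using h
  exact id w

theorem comp {q : wordObj L w ⟶ wordObj L w'} {q' : wordObj L w' ⟶ wordObj L w''}
    (h : Realizes p b q) (h' : Realizes p b' q') : Realizes p (b' * b) (q ≫ q') where
  length_eq := h.length_eq.trans h'.length_eq
  smul_eq u hu o φ hw hw'' := by
    have hw' : (u.reverseAux w').length = r := by simpa [h'.length_eq] using hw''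
    rw [mul_smul, h.smul_eq u hu φ hw hw', h'.smul_eq u hu _ hw' hw'', lift_comp, Category.assoc]

theorem inv {q : wordObj L w ≅ wordObj L w'} (h : Realizes p b q.hom) :
    Realizes p b⁻¹ q.inv where
  length_eq := h.length_eq.symm
  smul_eq u hu o φ hw hw' := by
    rw [inv_smul_eq_iff, h.smul_eq u hu _ hw' hw, Category.assoc, ← lift_comp, q.inv_hom_id,
      lift_id, Category.comp_id]

theorem whiskerLeft {q : wordObj L w ⟶ wordObj L w'} (h : Realizes (p + 1) b q) (a : G × X) :
    Realizes (w := a :: w) (w' := a :: w') p b (letterObj L a ◁ q) where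
  length_eq := congrArg (· + 1) h.length_eq
  smul_eq u hu _ φ hw hw' := h.smul_eq (a :: u) (congrArg (· + 1) hu) φ hw hw'

theorem exchange_swap (a : G × X) {k l : G} (x : X)
    (hl : letterColor (fun x => color (L x)) a * k = l) (w : List (G × X)) :
    Realizes (w := a :: (k, x) :: w) (w' := (l, x) :: a :: w) p (gen r p)
      (exchange (swap (letterObj L a) (L x) (color_act _ _) hl) (wordObj L w)).hom where
  length_eq := rfl
  smul_eq := by
    subst hl
    rintro u rfl o φ hw hw'
    rw [gen_smul (by simp [List.reverseAux_eq] at hw; omega)]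
    exact step_lift u 0 (a :: (k, x) :: w) φ hw hw'

theorem unique {q q' : wordObj L w ⟶ wordObj L w'} (h : Realizes 0 b q) (h' : Realizes 0 b q')
    (hw : w.length = r) : q = q' := by
  have hw' : w'.length = r := h.length_eq.symm.trans hw
  have smul_eq := (h.smul_eq [] rfl (𝟙 _) hw hw').symm.trans (h'.smul_eq [] rfl (𝟙 _) hw hw')
  simpa [lift] using smul_eq

end Realizes

end PointedWord

/-! ### Trees -/

section Tree

open MonoidalCategory CrossedBraidedCategory BraidGroup

/-- The groupoid of all trees, not only the linear ones, over inputs with the colours `g`: a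
synonym of `GTree G X` whose morphisms are the formal morphisms modulo the relations. -/
def TreeCat {G : Type u} {X : Type v} (_ : X → G) : Type (max u v) := GTree G X

namespace TreeCat

variable {G : Type u} [Group G] {X : Type v} {g : X → G}

instance : Category (TreeCat g) where
  Hom s t := Quot (Rel g (s := s) (t := t))
  id s := Quot.mk _ (.id s)
  comp {_ _ _} := Quot.map₂ PreHom.comp (fun _ _ _ h => .comp_congr (.refl _) h)
    (fun _ _ _ h => .comp_congr h (.refl _))
  id_comp {_ _} f := Quot.inductionOn f fun _ => Quot.sound (.id_comp _)
  comp_id {_ _} f := Quot.inductionOn f fun _ => Quot.sound (.comp_id _)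
  assoc {_ _ _ _} f f' f'' := Quot.inductionOn f fun _ => Quot.inductionOn f' fun _ =>
    Quot.inductionOn f'' fun _ => Quot.sound (.comp_assoc _ _ _)

/-- The class of a formal morphism. -/
def mk {s t : TreeCat g} (f : PreHom g s t) : s ⟶ t := Quot.mk _ f

theorem mk_eq_iff {s t : TreeCat g} {f f' : PreHom g s t} : mk f = mk f' ↔ Rel g f f' :=
  Equivalence.quot_mk_eq_iff ⟨.refl, .symm, .trans⟩ f f'

/-- The class of a formal morphism, as an isomorphism. -/
def mkIso {s t : TreeCat g} (f : PreHom g s t) : s ≅ t where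
  hom := mk f
  inv := mk (.inv f)
  hom_inv_id := Quot.sound (.comp_inv f)
  inv_hom_id := Quot.sound (.inv_comp f)

/-- The product of two morphisms. -/
def mulHom {s t s' t' : TreeCat g} (f : s ⟶ t) (f' : s' ⟶ t') :
    Quiver.Hom (V := TreeCat g) (GTree.mul s s') (GTree.mul t t') :=
  Quot.map₂ PreHom.mulMap (fun _ _ _ h => .mul_congr (.refl _) h)
    (fun _ _ _ h => .mul_congr h (.refl _)) f f'

instance : MonoidalCategoryStruct (TreeCat g) where
  tensorObj s t := GTree.mul s t
  whiskerLeft s _ _ f := mulHom (𝟙 s) f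
  whiskerRight f s := mulHom f (𝟙 s)
  tensorHom f f' := mulHom f f'
  tensorUnit := GTree.unit
  associator s t u := mkIso (.alpha s t u)
  leftUnitor s := mkIso (.ell s)
  rightUnitor s := mkIso (.rho s)

instance : MonoidalCategory (TreeCat g) :=
  .ofTensorHom
    (id_tensorHom_id := fun _ _ => Quot.sound (.mul_id _ _))
    (id_tensorHom := fun _ _ _ _ => rfl)
    (tensorHom_id := fun _ _ => rfl)
    (tensorHom_comp_tensorHom := fun f₁ f₂ g₁ g₂ => Quot.inductionOn f₁ fun _ =>
      Quot.inductionOn f₂ fun _ => Quot.inductionOn g₁ fun _ => Quot.inductionOn g₂ fun _ =>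
      (Quot.sound (.mul_comp _ _ _ _)).symm)
    (associator_naturality := fun f₁ f₂ f₃ => Quot.inductionOn f₁ fun _ =>
      Quot.inductionOn f₂ fun _ => Quot.inductionOn f₃ fun _ => Quot.sound (.alpha_nat _ _ _))
    (leftUnitor_naturality := fun f => Quot.inductionOn f fun _ => Quot.sound (.ell_nat _))
    (rightUnitor_naturality := fun f => Quot.inductionOn f fun _ => Quot.sound (.rho_nat _))
    (pentagon := fun _ _ _ _ => Quot.sound (.pentagon _ _ _ _))
    (triangle := fun _ _ => Quot.sound (.triangle _ _))

instance : CrossedBraidedCategory G (TreeCat g) where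
  color s := GTree.color g s
  color_unit := rfl
  color_tensor _ _ := rfl
  act h :=
    { obj s := GTree.act h s
      map := Quot.map (PreHom.actMap h) fun _ _ H => .act_congr h H
      map_id s := Quot.sound (.act_id h s)
      map_comp f f' := Quot.inductionOn f fun _ => Quot.inductionOn f' fun _ =>
        Quot.sound (.act_comp h _ _) }
  color_act _ _ := rfl
  braid s t a ha := mkIso (.braid s t a ha)
  beta h s t := mkIso (.beta h s t)
  gamma {k h l} hl s := mkIso (.gamma k h l hl s)
  delta s := mkIso (.delta s)
  eps h := mkIso (.eps h)
  braid_naturality f f' a ha ha' := Quot.inductionOn f fun _ => Quot.inductionOn f' fun _ =>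
    Quot.sound (.braid_nat _ _ a ha ha')
  beta_naturality h _ _ _ _ f f' := Quot.inductionOn f fun _ => Quot.inductionOn f' fun _ =>
    Quot.sound (.beta_nat h _ _)
  gamma_naturality {k h l} hl _ _ f := Quot.inductionOn f fun _ =>
    Quot.sound (.gamma_nat k h l hl _)
  delta_naturality f := Quot.inductionOn f fun _ => Quot.sound (.delta_nat _)
  beta_assoc h s t u := Quot.sound (.G1 h s t u)
  eps_leftUnitor h s := Quot.sound (.G2_left h s)
  eps_rightUnitor h s := Quot.sound (.G2_right h s)
  gamma_one_left h s := Quot.sound (.G3_left h s)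
  gamma_one_right h s := Quot.sound (.G3_right h s)
  gamma_gamma {h₃ h₂ h₁ k l m} hk hl hm hm' s :=
    Quot.sound (.G4 h₃ h₂ h₁ k l m hk hl hm hm' s)
  gamma_beta {k h l} hl s t := Quot.sound (.G8 k h l hl s t)
  beta_braid {h a b l s} t ha hb hl hl' := Quot.sound (.G9 h s t a b l ha hb hl hl')
  braid_tensor_left {a b c s t} u ha hb hc hab := Quot.sound (.G10_right s t u a b c ha hb hc hab)
  braid_tensor_right {a s} t u ha := Quot.sound (.G10_left s t u a ha)

variable (g) in
/-- The input `x` as an operation. -/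
def leaf (x : X) : TreeCat g := GTree.leaf x

/-- The word of the leaves of `[k]t` with their labels, followed by the word `w`. -/
def nfWord : G → GTree G X → List (G × X) → List (G × X)
  | k, .leaf x, w => (k, x) :: w
  | _, .unit, w => w
  | k, .act h t, w => nfWord (k * h) t w
  | k, .mul s t, w => nfWord k s (nfWord k t w)

@[simp]
theorem length_nfWord (k : G) (t : GTree G X) (w : List (G × X)) :
    (nfWord k t w).length = t.size + w.length := by
  induction t generalizing k w with
  | leaf x => simp [nfWord, add_comm]
  | unit => simp [nfWord]
  | act h t ih => simp [nfWord, ih]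
  | mul s t ih ih' => simp [nfWord, ih, ih', add_assoc]

/-- The isomorphism from the product of `[k]t` and a word to its normal form. -/
def nf : ∀ (k : G) (t : GTree G X) (w : List (G × X)),
    (act (C := TreeCat g) k).obj t ⊗ wordObj (leaf g) w ≅ wordObj (leaf g) (nfWord k t w)
  | _, .leaf _, _ => Iso.refl _
  | k, .unit, w => absorbUnit k (wordObj (leaf g) w)
  | k, .act h t, w => absorbAct rfl (nf (k * h) t w)
  | k, .mul s t, w => absorbTensor k (nf k t w) (nf k s (nfWord k t w))

/-- The conjugate by the normal forms of a morphism `f`, labelled by `k` and in front of a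
word. -/
def nfMap (k : G) (w : List (G × X)) {s t : TreeCat g} (f : s ⟶ t) :
    wordObj (leaf g) (nfWord k s w) ⟶ wordObj (leaf g) (nfWord k t w) :=
  (nf k s w).inv ≫ (act k).map f ▷ _ ≫ (nf k t w).hom

theorem nfMap_id (k : G) (w : List (G × X)) (s : TreeCat g) : nfMap k w (𝟙 s) = 𝟙 _ := by
  simp [nfMap]

theorem nfMap_comp (k : G) (w : List (G × X)) {s t u : TreeCat g} (f : s ⟶ t) (f' : t ⟶ u) :
    nfMap k w (f ≫ f') = nfMap k w f ≫ nfMap k w f' := by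
  simp [nfMap]

theorem nfMap_act (k h : G) (w : List (G × X)) {s t : TreeCat g} (f : s ⟶ t) :
    nfMap k w ((act h).map f) = nfMap (k * h) w f :=
  absorbAct_conj_map _ _ _ _

theorem nfMap_tensor (k : G) (w : List (G × X)) {s t s' t' : TreeCat g} (f : s ⟶ s')
    (f' : t ⟶ t') :
    nfMap k w (f ⊗ₘ f') =
      ((nf k s (nfWord k t w)).inv ≫ (act k).obj s ◁ nfMap k w f' ≫
        (nf k s (nfWord k t' w)).hom) ≫ nfMap k (nfWord k t' w) f :=
  absorbTensor_conj_map _ _ _ _ _ _ _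

theorem realizes_nf_conj {r p : ℕ} {b : BraidGroup r} (k : G) (s : GTree G X)
    {w w' : List (G × X)} {q : wordObj (leaf g) w ⟶ wordObj (leaf g) w'}
    (hq : Realizes (p + s.size) b q) :
    Realizes p b ((nf k s w).inv ≫ (act (C := TreeCat g) k).obj s ◁ q ≫ (nf k s w').hom) := by
  induction s generalizing k p w w' with
  | leaf x =>
    have refl_conj {s t : TreeCat g} (f : s ⟶ t) :
        (Iso.refl s).inv ≫ f ≫ (Iso.refl t).hom = f := by simp
    have realizes_whiskerLeft := Realizes.whiskerLeft hq (k, x)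
    exact (refl_conj _).symm ▸ realizes_whiskerLeft
  | unit => exact (absorbUnit_conj k q).symm ▸ hq
  | act h s ih => exact (absorbAct_conj _ _ _ q).symm ▸ ih (k * h) hq
  | mul s t ih ih' =>
    rw [GTree.size_mul, ← add_assoc] at hq
    exact (absorbTensor_conj _ _ _ _ q).symm ▸ ih k (ih' k hq)

variable (g) in
/-- The normal form of `[k]t`, in front of the word `w`. -/
def nfPointed (k : G) (t : GTree G X) (w : List (G × X)) {n : ℕ} (hn : t.size + w.length = n) :
    PointedWord (leaf g) ((act (C := TreeCat g) k).obj t ⊗ wordObj (leaf g) w) n :=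
  ⟨nfWord k t w, (length_nfWord k t w).trans hn, (nf k t w).hom⟩

theorem nfPointed_act {k h l : G} (hl : k * h = l) (t : GTree G X) (w : List (G × X)) {n : ℕ}
    (hn : t.size + w.length = n) :
    nfPointed g k (.act h t) w hn =
      ⟨nfWord l t w, (length_nfWord l t w).trans hn, (absorbAct hl (nf l t w)).hom⟩ := by
  subst hl
  rfl

/-- The morphism `f`, as part of a larger operation and with `p` inputs in front, acts on the
normal forms as the braid `b p`. -/
structure ActsAs {r : ℕ} (b : ℕ → BraidGroup r) {s t : TreeCat g} (f : s ⟶ t) : Prop where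
  realizes (k : G) (w : List (G × X)) (p : ℕ) : Realizes p (b p) (nfMap k w f)

namespace ActsAs

variable {r : ℕ} {b b' : ℕ → BraidGroup r}

theorem id (s : TreeCat g) : ActsAs (1 : ℕ → BraidGroup r) (𝟙 s) where
  realizes k w _ := (nfMap_id k w s).symm ▸ Realizes.id _

theorem comp {s t u : TreeCat g} {f : s ⟶ t} {f' : t ⟶ u} (hf : ActsAs b f) (hf' : ActsAs b' f') :
    ActsAs (b' * b) (f ≫ f') where
  realizes k w p := (nfMap_comp k w f f').symm ▸ (hf.realizes k w p).comp (hf'.realizes k w p)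

theorem inv {s t : TreeCat g} {f : s ≅ t} (hf : ActsAs b f.hom) : ActsAs b⁻¹ f.inv where
  realizes k w p := Realizes.inv (hf.realizes k w p) (q :=
    { hom := nfMap k w f.hom
      inv := nfMap k w f.inv
      hom_inv_id := by rw [← nfMap_comp, f.hom_inv_id, nfMap_id]
      inv_hom_id := by rw [← nfMap_comp, f.inv_hom_id, nfMap_id] })

theorem act_map (h : G) {s t : TreeCat g} {f : s ⟶ t} (hf : ActsAs b f) :
    ActsAs b ((act h).map f) where
  realizes k w p := (nfMap_act k h w f).symm ▸ hf.realizes (k * h) w p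

theorem tensor {s t s' t' : TreeCat g} {f : s ⟶ s'} {f' : t ⟶ t'} (hf : ActsAs b f)
    (hf' : ActsAs b' f') : ActsAs (fun p => b p * b' (p + GTree.size s)) (f ⊗ₘ f') where
  realizes k w p := (nfMap_tensor k w f f').symm ▸
    (realizes_nf_conj k s (hf'.realizes k w _)).comp (hf.realizes k _ p)

theorem whiskerLeft (s : TreeCat g) {t t' : TreeCat g} {f : t ⟶ t'} (hf : ActsAs b f) :
    ActsAs (fun p => b (p + GTree.size s)) (s ◁ f) := by
  simpa using (ActsAs.id s).tensor hf

theorem whiskerRight {s s' : TreeCat g} {f : s ⟶ s'} (hf : ActsAs b f) (t : TreeCat g) :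
    ActsAs b (f ▷ t) := by
  simpa using hf.tensor (ActsAs.id t)

theorem of_eq {s t : TreeCat g} {f f' : s ⟶ t} (hf : ActsAs b f) (h : f' = f)
    (hb : ∀ p, b' p = b p) : ActsAs b' f' := by
  rwa [h, funext hb]

theorem of_nfPointed_eq {s t : TreeCat g} (f : PreHom g s t)
    (H : ∀ k w n hn hn', nfPointed g (n := n) k s w hn =
      (nfPointed g k t w hn').pre ((act k).map (TreeCat.mk f) ▷ _)) :
    ActsAs (1 : ℕ → BraidGroup r) (TreeCat.mk f) where
  realizes k w _ := Realizes.of_pointedWord_eq (φ := (nf k s w).hom) <|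
    (H k w _ rfl (congrArg (· + w.length) f.size_eq.symm)).trans <|
      PointedWord.mk_congr (Iso.hom_inv_id_assoc _ _).symm

theorem associator (s t u : TreeCat g) : ActsAs (1 : ℕ → BraidGroup r) (α_ s t u).hom :=
  of_nfPointed_eq _ fun _ _ _ _ _ => PointedWord.mk_congr (map_associator_absorbTensor ..).symm

theorem leftUnitor (s : TreeCat g) : ActsAs (1 : ℕ → BraidGroup r) (λ_ s).hom :=
  of_nfPointed_eq _ fun _ _ _ _ _ => PointedWord.mk_congr (map_leftUnitor_absorb _).symm

theorem rightUnitor (s : TreeCat g) : ActsAs (1 : ℕ → BraidGroup r) (ρ_ s).hom :=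
  of_nfPointed_eq _ fun _ _ _ _ _ => PointedWord.mk_congr (map_rightUnitor_absorb _).symm

theorem beta (h : G) (s t : TreeCat g) :
    ActsAs (1 : ℕ → BraidGroup r) (CrossedBraidedCategory.beta h s t).hom :=
  of_nfPointed_eq _ fun _ _ _ _ _ => PointedWord.mk_congr (map_beta_absorbAct ..).symm

theorem gamma {k h l : G} (hl : k * h = l) (s : TreeCat g) :
    ActsAs (1 : ℕ → BraidGroup r) (CrossedBraidedCategory.gamma hl s).hom :=
  of_nfPointed_eq _ fun m w _ _ hn' =>
    (PointedWord.mk_congr (map_gamma_absorbAct rfl hl rfl (by rw [← hl, mul_assoc]) _).symm).trans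
      (congrArg (PointedWord.pre ((act m).map (CrossedBraidedCategory.gamma hl s).hom ▷ _))
        (nfPointed_act (by rw [← hl, mul_assoc]) s w hn').symm)

theorem delta (s : TreeCat g) :
    ActsAs (1 : ℕ → BraidGroup r) (CrossedBraidedCategory.delta s).hom :=
  of_nfPointed_eq _ fun k w _ hn _ => (nfPointed_act (mul_one k) s w hn).trans <|
    PointedWord.mk_congr <|
      congrArg (· ▷ _ ≫ (nf k s w).hom) (gamma_one_right k s)

theorem eps (h : G) :
    ActsAs (1 : ℕ → BraidGroup r) (CrossedBraidedCategory.eps (C := TreeCat g) h).hom :=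
  of_nfPointed_eq _ fun _ _ _ _ _ => PointedWord.mk_congr (map_eps_absorbUnit ..).symm

end ActsAs

variable {r : ℕ}

@[simp]
theorem size_tensor (s t : TreeCat g) :
    GTree.size (s ⊗ t : TreeCat g) = GTree.size s + GTree.size t :=
  GTree.size_mul s t

@[simp]
theorem size_tensorUnit : GTree.size (𝟙_ (TreeCat g)) = 0 :=
  rfl

@[simp]
theorem size_act_obj (h : G) (s : TreeCat g) :
    GTree.size ((act (C := TreeCat g) h).obj s) = GTree.size s :=
  rfl

/-- Braiding `s` past `t` acts as the block braid on their inputs. -/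
def BraidActsAsBlock (r : ℕ) (s t : TreeCat g) : Prop :=
  ∀ {a : G} (ha : color s = a),
    ActsAs (fun p => block r p (GTree.size s) (GTree.size t)) (braid s t ha).hom

namespace BraidActsAsBlock

theorem of_iso {s s' t t' : TreeCat g} {e : s ≅ s'} {e' : t ≅ t'}
    (he : ActsAs (1 : ℕ → BraidGroup r) e.hom) (he' : ActsAs (1 : ℕ → BraidGroup r) e'.hom)
    (hc : color s = color s') (H : BraidActsAsBlock r s t)
    (hs : GTree.size s' = GTree.size s := by rfl) (ht : GTree.size t' = GTree.size t := by rfl) :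
    BraidActsAsBlock r s' t' := fun {a} ha => by
  have conj : ActsAs _ (tensorIso e e').hom := he.tensor he'
  refine ((conj.inv.comp (H (hc.trans ha))).comp ((he'.act_map a).tensor he)).of_eq ?_ fun p => ?_
  · rw [Category.assoc, ← braid_naturality]
    exact (Iso.inv_hom_id_assoc _ _).symm
  · simp [hs, ht]

theorem tensor_left {s t u : TreeCat g} (hs : ∀ u, BraidActsAsBlock r s u)
    (ht : BraidActsAsBlock r t u) : BraidActsAsBlock r (s ⊗ t) u := fun {a} ha => by
  have hexagon := braid_tensor_left u rfl rfl ha ((color_tensor s t).symm.trans ha)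
  rw [Iso.comp_inv_eq] at hexagon
  refine ActsAs.of_eq (.comp (.comp (.associator ..) (.comp ((ht rfl).whiskerLeft s)
    (.comp (ActsAs.associator ..).inv (.comp ((hs _ rfl).whiskerRight t)
      (((ActsAs.gamma ..).whiskerRight s).whiskerRight t))))) (.associator ..))
    hexagon fun p => ?_
  simp [block_add_left]

theorem tensor_right {s t u : TreeCat g} (ht : BraidActsAsBlock r s t)
    (hu : BraidActsAsBlock r s u) : BraidActsAsBlock r s (t ⊗ u) := fun {a} ha => by
  refine ActsAs.of_eq (.comp (ActsAs.associator ..).inv (.comp ((ht ha).whiskerRight u)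
    (.comp (.associator ..) (.comp ((hu ha).whiskerLeft _) (.comp (ActsAs.associator ..).inv
      ((ActsAs.beta ..).whiskerRight s))))))
    (braid_tensor_right_eq t u ha) fun p => ?_
  simp [block_add_right]

theorem act_act {s t : TreeCat g} (h : G) (H : BraidActsAsBlock r s t) :
    BraidActsAsBlock r ((act h).obj s) ((act h).obj t) := fun {b} hb => by
  have hl : b * h = h * color s := by rw [← hb, color_act]; simp
  have equivariance := beta_braid t rfl hb rfl hl
  have eq : (braid _ _ hb).hom = ((beta h s t).hom ≫ (act h).map (braid s t rfl).hom ≫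
      (beta h _ s).inv ≫ (gamma rfl t).hom ▷ _) ≫ (gamma hl t).inv ▷ _ := by
    simp [equivariance]
  refine ActsAs.of_eq (.comp (.comp (ActsAs.beta ..) (.comp ((H rfl).act_map h)
    (.comp (ActsAs.beta ..).inv ((ActsAs.gamma ..).whiskerRight _))))
      ((ActsAs.gamma ..).inv.whiskerRight _)) eq fun p => ?_
  simp

theorem unit_left (t : TreeCat g) : BraidActsAsBlock r (𝟙_ (TreeCat g)) t := by
  rintro _ rfl
  exact ActsAs.of_eq
    (.comp (.leftUnitor t) (.comp (ActsAs.delta t).inv (ActsAs.rightUnitor _).inv))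
    (braid_unit_left t) fun p => by simp

theorem unit_right (s : TreeCat g) : BraidActsAsBlock r s (𝟙_ (TreeCat g)) := fun {a} ha =>
  ActsAs.of_eq
    (.comp (.rightUnitor s) (.comp (ActsAs.leftUnitor s).inv
      ((ActsAs.eps a).inv.whiskerRight s)))
    (braid_unit_right ha) fun p => by simp

theorem leaf_leaf (h : G) (x y : X) :
    BraidActsAsBlock r ((act h).obj (leaf g x)) (leaf g y) := fun {a} ha => by
  refine ⟨fun k w p => ?_⟩
  have hl : letterColor (fun x => color (leaf g x)) (k * h, x) * k = k * a := by
    rw [← ha, color_act]; simp [letterColor, mul_assoc]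
  have swap_eq : nfMap k w (braid _ (leaf g y) ha).hom =
      (exchange (swap (letterObj (leaf g) (k * h, x)) (leaf g y) (color_act _ _) hl) _).hom :=
    absorb_braid rfl rfl ha _ hl (wordObj (leaf g) w)
  have realizes_swap : Realizes p (gen r p) _ := Realizes.exchange_swap (k * h, x) y hl w
  rw [← swap_eq, ← block_one_one p] at realizes_swap
  exact realizes_swap

theorem act_leaf (h : G) (x : X) (t : TreeCat g) :
    BraidActsAsBlock r ((act h).obj (leaf g x)) t := by
  induction t generalizing h with
  | leaf y => exact leaf_leaf h x y
  | unit => exact unit_right _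
  | act l t ih =>
    exact of_iso (.gamma (mul_inv_cancel_left l h) (leaf g x)) (e' := Iso.refl _) (.id _)
      (by simp [color_act, mul_assoc])
      (act_act l (ih (l⁻¹ * h)))
  | mul t t' ih ih' => exact tensor_right (ih h) (ih' h)

theorem of_trees (s t : TreeCat g) : BraidActsAsBlock r s t := by
  induction s generalizing t with
  | leaf x =>
    exact of_iso (.delta (leaf g x)) (e' := Iso.refl _) (.id _) (by simp [color_act])
      (act_leaf 1 x t)
  | unit => exact unit_left t
  | act h s ih =>
    exact of_iso (e := Iso.refl _) (.id _) (e' := gamma (mul_inv_cancel h) t ≪≫ delta t)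
      (by simpa using (ActsAs.gamma _ t).comp (.delta t)) rfl (act_act h (ih _))
  | mul s s' ih ih' => exact tensor_left ih (ih' t)

end BraidActsAsBlock

theorem actsAs_mk {s t : TreeCat g} (f : PreHom g s t) :
    ActsAs (fun p => f.toBraid r p) (mk f) := by
  induction f with
  | id s => exact .id s
  | comp _ _ ih ih' => exact ih.comp ih'
  | inv f ih => exact ih.inv (f := mkIso f)
  | actMap h _ ih => exact ih.act_map h
  | mulMap _ _ ih ih' => exact ih.tensor ih'
  | alpha s t u => exact .associator s t u
  | ell s => exact .leftUnitor s
  | rho s => exact .rightUnitor s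
  | braid s t a ha => exact BraidActsAsBlock.of_trees s t ha
  | beta h s t => exact .beta h s t
  | gamma k h l hl s => exact .gamma hl s
  | delta s => exact .delta s
  | eps h => exact .eps h

theorem nfMap_injective {s t : TreeCat g} :
    Function.Injective (nfMap 1 [] : (s ⟶ t) → _) := by
  intro f f' eq
  rw [nfMap, nfMap, cancel_epi, cancel_mono] at eq
  have act_eq : (act (1 : G)).map f = (act 1).map f' := (whiskerRight_iff _ _).1 eq
  rw [← cancel_epi (delta s).hom, ← delta_naturality, act_eq, delta_naturality]

theorem rel_iff_toBraid_eq {r : ℕ} {s t : GTree G X} (hs : s.size = r) {f f' : PreHom g s t} :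
    Rel g f f' ↔ f.toBraid r 0 = f'.toBraid r 0 := by
  refine ⟨fun h => h.toBraid_eq (by omega), fun h => mk_eq_iff.1 (nfMap_injective ?_)⟩
  have realizes := (actsAs_mk (r := r) f).realizes 1 [] 0
  have realizes' := (actsAs_mk (r := r) f').realizes 1 [] 0
  exact realizes.unique (h ▸ realizes') (by simp [hs])

variable (g) in
/-- The product of the letters of a word, as a tree. -/
abbrev wordTree (w : List (G × X)) : GTree G X :=
  wordObj (C := TreeCat g) (leaf g) w

variable (g) in
theorem wordTree_cons (a : G × X) (w : List (G × X)) :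
    wordTree g (a :: w) = .mul (.act a.1 (.leaf a.2)) (wordTree g w) :=
  rfl

theorem nonempty_preHom_nf (s : TreeCat g) :
    Nonempty (PreHom g s (wordTree g (nfWord 1 s []))) :=
  ⟨(Quot.exists_rep ((ρ_ s).inv ≫ (delta s).inv ▷ _ ≫ (nf 1 s []).hom)).choose⟩

theorem nfWord_wordTree (w v : List (G × X)) : nfWord 1 (wordTree g w) v = w ++ v := by
  induction w with
  | nil => rfl
  | cons a w ih => simp [wordTree_cons, nfWord, ih]

theorem map_snd_nfWord (k : G) (t : GTree G X) (w : List (G × X)) :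
    (nfWord k t w).map Prod.snd = t.leaves ++ w.map Prod.snd := by
  induction t generalizing k w with
  | leaf => rfl
  | unit => rfl
  | act h _ ih => exact ih _ _
  | mul s t ih ih' => simp [nfWord, ih, ih', GTree.leaves]

theorem prod_letterColor_nfWord (k : G) (t : GTree G X) (w : List (G × X)) :
    ((nfWord k t w).map (letterColor g)).prod =
      k * t.color g * k⁻¹ * (w.map (letterColor g)).prod := by
  induction t generalizing k w with
  | leaf => simp [nfWord, letterColor, GTree.color]
  | unit => simp [nfWord, GTree.color]
  | act h t ih => simp [nfWord, ih, GTree.color, mul_assoc]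
  | mul s t ih ih' => simp [nfWord, ih, ih', GTree.color, mul_assoc]

theorem leaves_wordTree (w : List (G × X)) :
    (wordTree g w).leaves = w.map Prod.snd := by
  have := map_snd_nfWord 1 (wordTree g w) []
  rw [nfWord_wordTree] at this
  simpa using this.symm

theorem color_wordTree (w : List (G × X)) :
    (wordTree g w).color g = (w.map (letterColor g)).prod := by
  have := prod_letterColor_nfWord (g := g) 1 (wordTree g w) []
  rw [nfWord_wordTree] at this
  simpa using this.symm

theorem exists_toBraid_eq_gen {r : ℕ} : ∀ (j p : ℕ) (w : List (G × X)), j + 1 < w.length →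
    ∃ f : PreHom g (wordTree g w) (wordTree g (wordStep g j w)),
      f.toBraid r p = gen r (p + j)
  | 0, p, (k, x) :: (l, y) :: w, _ => by
    let c := letterColor g (k, x)
    let swap := .braid (.act k (.leaf x)) (.act l (.leaf y)) c rfl ⋙ₚ
      .mulMap (.gamma c l (c * l) rfl (.leaf y)) (.id _)
    have toBraid_swap : swap.toBraid r p = gen r p := by simp [swap, PreHom.toBraid]
    refine ⟨.inv (.alpha _ _ (wordTree g w)) ⋙ₚ .mulMap swap (.id _) ⋙ₚ .alpha _ _ _, ?_⟩
    change 1 * (swap.toBraid r p * 1) * 1⁻¹ = _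
    rw [toBraid_swap, one_mul, mul_one, inv_one, mul_one, add_zero]
  | j + 1, p, a :: w, hj => by
    obtain ⟨f, hf⟩ := exists_toBraid_eq_gen (r := r) j (p + 1) w (by simpa using hj)
    refine ⟨.mulMap (.id (.act a.1 (.leaf a.2))) f, ?_⟩
    change 1 * f.toBraid r (p + 1) = _
    rw [one_mul, hf, add_assoc, add_comm 1]

end TreeCat

end Tree

/-! ### Permutations and labels -/

section SigmaSet

open TreeCat

variable {G : Type u} {r : ℕ}

/-- The word of an element of `Σ_r × G^r`: its `p`-th letter is the input placed at `p` with the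
label of `p`. -/
def toWord (x : Equiv.Perm (Fin r) × (Fin r → G)) : List (G × Fin r) :=
  List.ofFn fun p => (x.2 p, x.1⁻¹ p)

@[simp]
theorem length_toWord (x : Equiv.Perm (Fin r) × (Fin r → G)) : (toWord x).length = r := by
  simp [toWord]

theorem toWord_injective : Function.Injective (toWord (G := G) (r := r)) := by
  rintro ⟨σ, b⟩ ⟨σ', b'⟩ h
  have letter_eq := congrFun (List.ofFn_injective h)
  have perm_eq : σ⁻¹ = σ'⁻¹ := Equiv.ext fun p => congrArg Prod.snd (letter_eq p)
  have label_eq : b = b' := funext fun p => congrArg Prod.fst (letter_eq p)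
  rw [label_eq, inv_injective perm_eq]

theorem map_snd_toWord (x : Equiv.Perm (Fin r) × (Fin r → G)) :
    (toWord x).map Prod.snd = List.ofFn ⇑x.1⁻¹ := by
  rw [toWord, List.map_ofFn]
  rfl

theorem exists_toWord_eq {w : List (G × Fin r)} (hw : (w.map Prod.snd).Nodup)
    (hw' : ∀ x, x ∈ w.map Prod.snd) : ∃ x, toWord x = w := by
  let e := hw.getEquivOfForallMemList _ hw'
  have length_eq : (w.map Prod.snd).length = r := by simpa using Fintype.card_congr e
  refine ⟨(((finCongr length_eq.symm).trans e)⁻¹,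
    fun p => (w[(p : ℕ)]'(by simpa using p.2.trans_eq length_eq.symm)).1), ?_⟩
  refine List.ext_getElem (by simpa using length_eq.symm) fun i _ _ => ?_
  simp [toWord, e]

variable [Group G]

theorem getElem_wordStep {X : Type*} (g : X → G) (j : ℕ) (w : List (G × X))
    (hj : j + 1 < w.length) (i : ℕ) (hi : i < (wordStep g j w).length) (hi' : i < w.length) :
    (wordStep g j w)[i] = if i = j then (letterColor g w[j] * w[j + 1].1, w[j + 1].2)
      else if i = j + 1 then w[j] else w[i] := by
  fun_induction wordStep g j w generalizing i with
  | case1 a b w => rcases i with _ | _ | i <;> simp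
  | case2 j a w ih =>
    rcases i with _ | i
    · simp
    · simpa using ih (by simpa using hj) i (by simpa using hi) (by simpa using hi')
  | case3 j w _ _ =>
    rcases j with _ | j <;> rcases w with _ | ⟨a, _ | ⟨b, w⟩⟩ <;>
      first | (simp at hj; done) | simp_all

variable {h : G} {g : Fin r → G}

theorem wordStep_toWord (j : Fin (r - 1)) (x : Equiv.Perm (Fin r) × (Fin r → G)) :
    wordStep g j (toWord x) = toWord (braidStep g j x) := by
  have hj : (j : ℕ) + 1 < r := by omega
  refine List.ext_getElem (by simp) fun i h_step h_word => ?_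
  have hi : i < r := by simpa using h_word
  rw [getElem_wordStep g j _ (by simpa using hj) i h_step (by simpa using hi)]
  have eq_lo : (⟨i, hi⟩ : Fin r) = lo j ↔ i = j := by simp [lo, Fin.ext_iff]
  have eq_hi : (⟨i, hi⟩ : Fin r) = GBraid.hi j ↔ i = j + 1 := by simp [GBraid.hi, Fin.ext_iff]
  simp only [toWord, List.getElem_ofFn, braidStep, mul_inv_rev, Equiv.Perm.mul_apply,
    Equiv.swap_inv, eq_lo, eq_hi]
  split_ifs with h_lo h_hi
  · rw [eq_lo.2 h_lo, Equiv.swap_apply_left]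
    rfl
  · rw [eq_hi.2 h_hi, Equiv.swap_apply_right]
    rfl
  · rw [Equiv.swap_apply_of_ne_of_ne (mt eq_lo.1 h_lo) (mt eq_hi.1 h_hi)]

theorem map_letterColor_toWord (x : Equiv.Perm (Fin r) × (Fin r → G)) :
    (toWord x).map (letterColor g) = List.ofFn (posColor g x) := by
  rw [toWord, List.map_ofFn]
  rfl

theorem toWord_of_smul (j : Fin (r - 1)) (x : SigmaSet h g) :
    toWord ((PresentedGroup.of j : BraidGroup r) • x).1 = wordStep g j (toWord x.1) := by
  rw [of_smul_val, wordStep_toWord]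

theorem word_smul_eq_toWord_iff {o : TreeCat g} (b : BraidGroup r)
    (e : PointedWord (leaf g) o r) (x : SigmaSet h g) :
    (b • e).word = toWord (b • x).1 ↔ e.word = toWord x.1 := by
  induction b using BraidGroup.induction_on generalizing e x with
  | of j =>
    rw [toWord_of_smul, ← BraidGroup.gen_eq_of, PointedWord.gen_smul (by omega)]
    exact (wordStep_leftInverse g j).injective.eq_iff
  | one => rw [one_smul, one_smul]
  | mul b b' ih ih' => rw [mul_smul, mul_smul, ih, ih']
  | inv b ih => simpa using (ih (b⁻¹ • e) (b⁻¹ • x)).symm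

end SigmaSet

/-! ### The equivalence -/

namespace PBr

open TreeCat

variable {G : Type u} [Group G] {r : ℕ} {h : G} {g : Fin r → G}

theorem size_tree (s : PBr h g) : s.tree.size = r := by
  simpa [GTree.size] using
    Fintype.card_congr (s.isLinear.1.getEquivOfForallMemList _ s.isLinear.2)

theorem exists_toWord_eq_nfWord (s : PBr h g) :
    ∃ x : SigmaSet h g, toWord x.1 = nfWord 1 s.tree [] := by
  obtain ⟨x, hx⟩ := exists_toWord_eq (w := nfWord 1 s.tree [])
    (by simpa [map_snd_nfWord] using s.isLinear.1) (by simpa [map_snd_nfWord] using s.isLinear.2)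
  refine ⟨⟨x, ?_⟩, hx⟩
  rw [← map_letterColor_toWord, hx, prod_letterColor_nfWord, s.color_eq]
  simp

/-- The element of `Σ_r ×_h G^r` whose word is the normal form of an operation. -/
noncomputable def toSigma (s : PBr h g) : SigmaSet h g :=
  s.exists_toWord_eq_nfWord.choose

theorem toWord_toSigma (s : PBr h g) : toWord s.toSigma.1 = nfWord 1 s.tree [] :=
  s.exists_toWord_eq_nfWord.choose_spec

/-- The standard operation of an element of `Σ_r ×_h G^r`: the product of its letters. -/
def ofSigma (x : SigmaSet h g) : PBr h g where
  tree := wordTree g (toWord x.1)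
  color_eq := by rw [color_wordTree, map_letterColor_toWord, x.2]
  isLinear := by
    rw [GTree.IsLinear, leaves_wordTree, map_snd_toWord]
    exact ⟨List.nodup_ofFn.2 x.1.1⁻¹.injective,
      fun y => (List.mem_ofFn' _ _).2 (x.1.1⁻¹.surjective y)⟩

theorem ofSigma_tree (x : SigmaSet h g) : (ofSigma x).tree = wordTree g (toWord x.1) :=
  rfl

theorem toSigma_ofSigma (x : SigmaSet h g) : (ofSigma x).toSigma = x :=
  Subtype.ext (toWord_injective ((toWord_toSigma _).trans
    ((nfWord_wordTree _ _).trans (List.append_nil _))))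

theorem nonempty_preHom_ofSigma (s : PBr h g) :
    Nonempty (PreHom g s.tree (ofSigma s.toSigma).tree) := by
  rw [ofSigma_tree, toWord_toSigma]
  exact nonempty_preHom_nf s.tree

theorem toBraid_smul_toSigma {s t : PBr h g} (f : PreHom g s.tree t.tree) :
    f.toBraid r 0 • s.toSigma = t.toSigma := by
  have length_eq {s : PBr h g} : (nfWord 1 s.tree []).length = r := by simp [s.size_tree]
  have smul_eq := ((actsAs_mk (r := r) f).realizes 1 [] 0).smul_eq [] rfl (𝟙 _) length_eq length_eq
  have word_eq := (word_smul_eq_toWord_iff (f.toBraid r 0)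
    (.ofWord (L := leaf g) (nfWord 1 s.tree []) length_eq) s.toSigma).2 s.toWord_toSigma.symm
  refine Subtype.ext (toWord_injective ?_)
  rw [← word_eq, t.toWord_toSigma]
  exact congrArg PointedWord.word smul_eq

theorem exists_toBraid_eq_ofSigma (b : BraidGroup r) {x y : SigmaSet h g} (hb : b • x = y) :
    ∃ f : PreHom g (ofSigma x).tree (ofSigma y).tree, f.toBraid r 0 = b := by
  induction b using BraidGroup.induction_on generalizing x y with
  | of j =>
    obtain ⟨f, hf⟩ := exists_toBraid_eq_gen (g := g) (r := r) j 0 (toWord x.1)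
      (by rw [length_toWord]; omega)
    rw [← hb, ofSigma_tree, ofSigma_tree, toWord_of_smul]
    exact ⟨f, by rw [hf, zero_add, BraidGroup.gen_eq_of]⟩
  | one =>
    rw [← hb, one_smul]
    exact ⟨.id _, rfl⟩
  | mul b b' ih ih' =>
    obtain ⟨f', hf'⟩ := ih' (x := x) rfl
    obtain ⟨f, hf⟩ := ih ((mul_smul _ _ _).symm.trans hb)
    exact ⟨f' ⋙ₚ f, by rw [PreHom.toBraid, hf, hf']⟩
  | inv b ih =>
    obtain ⟨f, hf⟩ := ih (inv_smul_eq_iff.1 hb).symm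
    exact ⟨.inv f, congrArg (·⁻¹) hf⟩

theorem exists_toBraid_eq {s t : PBr h g} (b : BraidGroup r) (hb : b • s.toSigma = t.toSigma) :
    ∃ f : PreHom g s.tree t.tree, f.toBraid r 0 = b := by
  obtain ⟨e⟩ := s.nonempty_preHom_ofSigma
  obtain ⟨e'⟩ := t.nonempty_preHom_ofSigma
  have smul_s := toBraid_smul_toSigma e
  have smul_t := toBraid_smul_toSigma e'
  rw [toSigma_ofSigma] at smul_s smul_t
  obtain ⟨f, hf⟩ := exists_toBraid_eq_ofSigma (e'.toBraid r 0 * b * (e.toBraid r 0)⁻¹)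
    (x := s.toSigma) (y := t.toSigma)
    (by rw [mul_smul, mul_smul, inv_smul_eq_iff.2 smul_s.symm, hb, smul_t])
  exact ⟨e ⋙ₚ f ⋙ₚ .inv e', by simp [PreHom.toBraid, hf, mul_assoc]⟩

/-- The braid of a morphism between operations. -/
def homBraid {s t : PBr h g} (f : s ⟶ t) : BraidGroup r :=
  Quot.lift (fun f : PreHom g s.tree t.tree => f.toBraid r 0)
    (fun _ _ => (rel_iff_toBraid_eq s.size_tree).1) f

end PBr

section Functor

variable {G : Type u} [Group G] {r : ℕ} (h : G) (g : Fin r → G)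

/-- The functor sending a morphism of operations to its braid. -/
noncomputable def braidFunctor : PBr h g ⥤ ActionCategory (BraidGroup r) (SigmaSet h g) where
  obj s := ⟨(), s.toSigma⟩
  map f := ⟨PBr.homBraid f, Quot.inductionOn f PBr.toBraid_smul_toSigma⟩
  map_id _ := rfl
  map_comp f f' := Subtype.ext (Quot.inductionOn f fun _ => Quot.inductionOn f' fun _ => rfl)

instance : (braidFunctor h g).Faithful where
  map_injective {s _ f f'} eq := by
    obtain ⟨f, rfl⟩ := Quot.exists_rep f
    obtain ⟨f', rfl⟩ := Quot.exists_rep f'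
    exact Quot.sound ((TreeCat.rel_iff_toBraid_eq s.size_tree).2 (congrArg Subtype.val eq))

instance : (braidFunctor h g).Full where
  map_surjective := by
    rintro s t ⟨b, hb⟩
    obtain ⟨f, hf⟩ := PBr.exists_toBraid_eq (s := s) (t := t) b hb
    exact ⟨Quot.mk _ f, Subtype.ext hf⟩

instance : (braidFunctor h g).EssSurj where
  mem_essImage := by
    rintro ⟨⟨⟩, x⟩
    refine ⟨PBr.ofSigma x, ⟨eqToIso ?_⟩⟩
    exact congrArg (fun x => (⟨(), x⟩ : ActionCategory (BraidGroup r) (SigmaSet h g)))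
      (PBr.toSigma_ofSigma x)

instance : (braidFunctor h g).IsEquivalence where

end Functor

end GBraid

theorem mainTheorem6 {G : Type u} [Group G] {r : ℕ} (h : G) (g : Fin r → G) :
    Nonempty (GBraid.PBr h g ≌ ActionCategory (GBraid.BraidGroup r) (GBraid.SigmaSet h g)) :=
  ⟨(GBraid.braidFunctor h g).asEquivalence⟩
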